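/- All polynomials are over $\mathbb{C}$. An arithmetic circuit is a finite acyclic directed graph with vertices of in-degree $0$ (inputs, labelled by a constant in $\mathbb{C}$ or a variable) or in-degree $2$ (gates, labelled by $+$ or $\times$; the two edges entering a gate may start at the same vertex) and exactly one vertex of out-degree $0$, whose value is the polynomial computed by the circuit; its size is the number of vertices. It is weakly-skew if for each multiplication gate $\alpha$ at least one of its two operands is computed by a separate subcircuit $C_\alpha$, meaning that the edge connecting $C_\alpha$ to $\alpha$ is the only edge between $C_\alpha$ and the remainder of the circuit. For $f\in A:=\mathbb{C}[X_1,X_2,\ldots]$ let $L_{\mathrm{ws}}(f)$ be the minimum size of a weakly-skew circuit computing $f$. Endow $A$ with the limit of the Euclidean topologies on the finite-dimensional subspaces $\{f\in\mathbb{C}[X_1,\ldots,X_n] : \deg f\le d\}$, and let $\underline{L}_{\mathrm{ws}}(f)$ be the minimum $r\in\mathbb{N}$ such that $f$ lies in the closure of $\{g\in A : L_{\mathrm{ws}}(g)\le r\}$. Let $\mathbf{VP}_{\mathrm{ws}}$ (respectively $\overline{\mathbf{VP}_{\mathrm{ws}}}$) be the set of sequences $(f_n)$ in $A$ such that $L_{\mathrm{ws}}(f_n)$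 (respectively $\underline{L}_{\mathrm{ws}}(f_n)$) is polynomially bounded in $n$. Let $R=\mathbb{C}[[\epsilon]]$, and let $\det_n\in S^n\mathbb{C}^{n^2}$ be the determinant, a form of degree $n$ in $n^2$ variables. The orbit closure of $\det_n$ is the Zariski closure of $GL_{n^2}(\mathbb{C})\cdot\det_n$ in $S^n\mathbb{C}^{n^2}$. A form $f\in S^n\mathbb{C}^{n^2}$ is approximated with order $q\in\mathbb{N}$ along a curve in the orbit of $\det_n$ if there are $R$-linear forms $y_1,\ldots,y_{n^2}$ in the $n^2$ variables, whose coefficient matrix is invertible over the quotient field of $R$, and a form $\tilde F\in S^nR^{n^2}$ such that $$\det\nolimits_n(y_1,\ldots,y_{n^2})=\epsilon^q f+\epsilon^{q+1}\tilde F.$$ **Proposition.** Suppose that there is a polynomial $p$ such that, for every $n$, every $f$ in the orbit closure of $\det_n$ can be approximated along a curve in the orbit of $\det_n$ with some order $q\le p(n)$. Then $\mathbf{VP}_{\mathrm{ws}}=\overline{\mathbf{VP}_{\mathrm{ws}}}$. -/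

import Mathlib

open scoped Matrix PowerSeries

namespace GCT

/-! ### Arithmetic circuits -/

/-- Vertex labels of an arithmetic circuit with vertex set `V`. Inputs (in-degree `0`) are labelled
by a constant or a variable; computation gates (in-degree `2`) are labelled by `+` or `×` and carry
their two operands. The two incoming edges of a gate are numbered by `Fin 2`, so that both may start
at the same vertex. -/
inductive Gate (σ R V : Type*) where
  | const (c : R)
  | var (i : σ)
  | add (a : Fin 2 → V)
  | mul (a : Fin 2 → V)

/-- The `i`-th incoming edge of a vertex labelled `g` exists and starts at `u`. -/
def Gate.HasOperand {σ R V : Type*} (g : Gate σ R V) (i : Fin 2) (u : V) : Prop :=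
  match g with
  | .const _ => False
  | .var _ => False
  | .add a => a i = u
  | .mul a => a i = u

/-- The value of a vertex labelled `g`, given the values `val` of all vertices. -/
noncomputable def Gate.value {σ R V : Type*} [CommSemiring R] (g : Gate σ R V)
    (val : V → MvPolynomial σ R) : MvPolynomial σ R :=
  match g with
  | .const c => MvPolynomial.C c
  | .var i => MvPolynomial.X i
  | .add a => val (a 0) + val (a 1)
  | .mul a => val (a 0) * val (a 1)

/-- An arithmetic circuit with vertex set `V` (assumed finite wherever circuits are used): an
acyclic directed graph with labelled vertices, in which exactly one vertex, the output, has
out-degree `0`. -/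
structure ArithCircuit (σ R V : Type*) where
  gate : V → Gate σ R V
  acyclic : ∀ v, ¬ Relation.TransGen (fun u w => ∃ i, (gate w).HasOperand i u) v v
  output : V
  outdegree_eq_zero_iff : ∀ u, (∀ w i, ¬ (gate w).HasOperand i u) ↔ u = output

namespace ArithCircuit

variable {σ R V : Type*}

/-- The `i`-th incoming edge of `v` starts at `u`. -/
def Wire (C : ArithCircuit σ R V) (u : V) (i : Fin 2) (v : V) : Prop :=
  (C.gate v).HasOperand i u

/-- `u` is a vertex of the subcircuit computing `v`, i.e. there is a directed (possibly empty) path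
from `u` to `v`. -/
def InSubcircuit (C : ArithCircuit σ R V) (u v : V) : Prop :=
  Relation.ReflTransGen (fun x y => ∃ i, C.Wire x i y) u v

/-- The circuit `C` computes `f`. By acyclicity there is exactly one assignment `val` of values to
the vertices that is compatible with the labels; see `existsUnique_val`. -/
def Computes [CommSemiring R] (C : ArithCircuit σ R V) (f : MvPolynomial σ R) : Prop :=
  ∃ val : V → MvPolynomial σ R, (∀ v, val v = (C.gate v).value val) ∧ val C.output = f

/-- The circuit `C` is weakly-skew: for each multiplication gate `α`, at least one of its two
operands is computed by a separate subcircuit, i.e. the edge from that subcircuit to `α` is the only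
edge between the subcircuit and the remainder of the circuit. (The subcircuit contains all
predecessors of its vertices, so that no edge leads from the remainder into it.) -/
def IsWeaklySkew (C : ArithCircuit σ R V) : Prop :=
  ∀ (α : V) (a : Fin 2 → V), C.gate α = Gate.mul a →
    ∃ i : Fin 2, ∀ (u : V) (j : Fin 2) (v : V),
      C.InSubcircuit u (a i) → ¬ C.InSubcircuit v (a i) → C.Wire u j v →
        u = a i ∧ j = i ∧ v = α

theorem wellFounded_wire [Finite V] (C : ArithCircuit σ R V) :
    WellFounded (fun u w => ∃ i, C.Wire u i w) := by
  have : Std.Irrefl (Relation.TransGen (fun u w => ∃ i, C.Wire u i w)) := ⟨C.acyclic⟩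
  have h := Finite.wellFounded_of_trans_of_irrefl
    (Relation.TransGen (fun u w => ∃ i, C.Wire u i w))
  exact Subrelation.wf (fun hab => Relation.TransGen.single hab) h

theorem existsUnique_val [CommSemiring R] [Finite V] (C : ArithCircuit σ R V) :
    ∃! val : V → MvPolynomial σ R, ∀ v, val v = (C.gate v).value val := by
  classical
  have key : ∀ (v : V) (x y : V → MvPolynomial σ R),
      (∀ u, (∃ i, C.Wire u i v) → x u = y u) → (C.gate v).value x = (C.gate v).value y := by
    intro v x y h
    unfold Wire at h
    cases hg : C.gate v with
    | const c => rfl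
    | var i => rfl
    | add a =>
      rw [hg] at h
      simp only [Gate.value]
      rw [h (a 0) ⟨0, rfl⟩, h (a 1) ⟨1, rfl⟩]
    | mul a =>
      rw [hg] at h
      simp only [Gate.value]
      rw [h (a 0) ⟨0, rfl⟩, h (a 1) ⟨1, rfl⟩]
  refine ⟨C.wellFounded_wire.fix fun v ih => (C.gate v).value
    fun u => if h : ∃ i, C.Wire u i v then ih u h else 0, ?_, ?_⟩
  · intro v
    rw [WellFounded.fix_eq]
    apply key
    intro u hu
    simp only [dif_pos hu]
  · intro y hy
    funext v
    induction v using C.wellFounded_wire.induction with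
    | _ v ih =>
      rw [WellFounded.fix_eq, hy v]
      apply key
      intro u hu
      simp only [dif_pos hu]
      exact ih u hu

end ArithCircuit

/-! ### Complexity classes -/

/-- `L_ws(f)`: the minimum size (number of vertices) of a weakly-skew arithmetic circuit computing
`f ∈ ℂ[X₀, X₁, …]`. -/
noncomputable def Lws (f : MvPolynomial ℕ ℂ) : ℕ∞ :=
  sInf {s : ℕ∞ | ∃ (V : Type) (_ : Fintype V) (C : ArithCircuit ℕ ℂ V),
    C.IsWeaklySkew ∧ C.Computes f ∧ (Fintype.card V : ℕ∞) = s}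

/-- The polynomials of degree at most `d` in the first `n` variables. -/
def polyPart (n d : ℕ) : Set (MvPolynomial ℕ ℂ) :=
  {f | (∀ i ∈ f.vars, i < n) ∧ f.totalDegree ≤ d}

/-- The Euclidean topology on the finite-dimensional space `polyPart n d`, in the coordinates given
by the coefficients (of which only finitely many are not identically zero on `polyPart n d`). -/
@[reducible] noncomputable def euclideanTopology (n d : ℕ) : TopologicalSpace (polyPart n d) :=
  TopologicalSpace.induced
    (fun f : polyPart n d => fun s : ℕ →₀ ℕ => MvPolynomial.coeff s f.1) inferInstance

/-- The limit topology on `ℂ[X₀, X₁, …]`: a set is open if and only if its intersection with each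
`polyPart n d` is open in the Euclidean topology. -/
@[reducible] noncomputable def limitTopology : TopologicalSpace (MvPolynomial ℕ ℂ) :=
  ⨆ (n : ℕ) (d : ℕ), TopologicalSpace.coinduced Subtype.val (euclideanTopology n d)

/-- The approximate complexity: the minimum `r` such that `f` lies in the closure of
`{g | L_ws(g) ≤ r}`. -/
noncomputable def approxLws (f : MvPolynomial ℕ ℂ) : ℕ∞ :=
  sInf {s : ℕ∞ | ∃ r : ℕ, f ∈ @closure _ limitTopology {g | Lws g ≤ r} ∧ (r : ℕ∞) = s}

/-- `t n` is finite and polynomially bounded in `n`. -/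
def PolynomiallyBounded (t : ℕ → ℕ∞) : Prop :=
  ∃ p : Polynomial ℕ, ∀ n : ℕ, t n ≤ ((p.eval n : ℕ) : ℕ∞)

/-- The class `VP_ws`. -/
def VPws : Set (ℕ → MvPolynomial ℕ ℂ) :=
  {f | PolynomiallyBounded fun n => Lws (f n)}

/-- The approximate class corresponding to `VP_ws`. -/
def approxVPws : Set (ℕ → MvPolynomial ℕ ℂ) :=
  {f | PolynomiallyBounded fun n => approxLws (f n)}

/-! ### The orbit of the determinant and the order of approximation -/

/-- The determinant `det_n`, a form of degree `n` in the `n²` variables `x_{ij}`. -/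
noncomputable def detPoly (n : ℕ) : MvPolynomial (Fin n × Fin n) ℂ :=
  (Matrix.mvPolynomialX (Fin n) (Fin n) ℂ).det

/-- `g(y)` for the `R`-linear forms `y_i = ∑ j, B i j x_j`, where `R` is a commutative
`ℂ`-algebra. -/
noncomputable def linSubst {σ R : Type*} [Fintype σ] [CommRing R] [Algebra ℂ R]
    (B : Matrix σ σ R) (g : MvPolynomial σ ℂ) : MvPolynomial σ R :=
  MvPolynomial.aeval (fun i => ∑ j, MvPolynomial.C (B i j) * MvPolynomial.X j) g

/-- The orbit of `det_n` under `GL_{n²}(ℂ)`, acting by invertible linear substitutions. -/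
def detOrbit (n : ℕ) : Set (MvPolynomial (Fin n × Fin n) ℂ) :=
  {f | ∃ A : GL (Fin n × Fin n) ℂ,
    f = linSubst (A : Matrix (Fin n × Fin n) (Fin n × Fin n) ℂ) (detPoly n)}

/-- The orbit closure of `det_n`: the Zariski closure of the orbit in the space of forms of degree
`n`, i.e. the forms at which every polynomial `P` in the coefficients vanishes that vanishes on the
orbit. -/
def detOrbitClosure (n : ℕ) : Set (MvPolynomial (Fin n × Fin n) ℂ) :=
  {f | f.IsHomogeneous n ∧ ∀ P : MvPolynomial (Fin n × Fin n →₀ ℕ) ℂ,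
    (∀ g ∈ detOrbit n, MvPolynomial.eval (fun s => MvPolynomial.coeff s g) P = 0) →
      MvPolynomial.eval (fun s => MvPolynomial.coeff s f) P = 0}

/-- `f` can be approximated with order `q` along a curve in the orbit of `det_n`: there are linear
forms `y` over `R = ℂ⟦ε⟧`, obtained from the variables by a matrix `B` over `R` that is invertible
over the quotient field of `R`, such that `det_n(y) = ε^q f + ε^{q+1} F` for some form `F` of degree
`n` over `R`. -/
def ApproximableWithOrder (n : ℕ) (f : MvPolynomial (Fin n × Fin n) ℂ) (q : ℕ) : Prop :=
  ∃ (B : Matrix (Fin n × Fin n) (Fin n × Fin n) ℂ⟦X⟧)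
    (F : MvPolynomial (Fin n × Fin n) ℂ⟦X⟧),
    B.det ≠ 0 ∧ F.IsHomogeneous n ∧
      linSubst B (detPoly n) =
        MvPolynomial.C (PowerSeries.X ^ q) *
            MvPolynomial.map (algebraMap ℂ ℂ⟦X⟧) f +
          MvPolynomial.C (PowerSeries.X ^ (q + 1)) * F

end GCT

/-!
`VP_ws` is contained in its approximate class, because the complexity of a polynomial bounds its
approximate complexity. For the converse, let `f` be a limit of polynomials `g` with `Lws g ≤ r`,
where `r` is polynomially bounded, and put `m = r + 1`.

*From circuits to the orbit closure.* Every such `g` is the determinant of an `m × m` matrix of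
affine linear polynomials (`exists_det_of_Lws_le`). To see this, multiply the value of each vertex
of the circuit by the values of the other operands of all multiplication gates whose separate
subcircuit contains the vertex. The products satisfy a linear system whose coefficients are affine
linear and which becomes unipotent and triangular in a suitable order of evaluation; Cramer's rule
gives the determinant. Since the invertible matrices are Zariski dense, the homogenization of `g`
satisfies all polynomial equations of the orbit of `det_m`. These equations are closed conditions
in the limit topology, as is the bound on the degree, while the number of variables is lower
semicontinuous. Hence `f` is a dehomogenization of a form `F` in the orbit closure of `det_m`
(`exists_mem_detOrbitClosure`).

*From curves to circuits.* By hypothesis, `F` is approximated with an order `q` that is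
polynomially bounded in `m`. Truncating the curve at order `q` makes `F` the coefficient of `ε^q`
in a polynomial of degree at most `m * q` in `ε`, whose values are determinants of matrices of
linear forms over `ℂ`; by interpolation, `F` is a linear combination of `m * q + 1` of them
(`ApproximableWithOrder.exists_eq_sum_linSubst`). Finally, Newton's identities express a
determinant through the traces of the powers of the matrix by recursion. A product
`p * tr (Y ^ k)` can be computed by multiplying the vectors `p • e_a` by `Y` again and again, so
that one factor of each multiplication is an input. Thus determinants have weakly-skew circuits of
polynomial size (`SkewCost.det`), and so does `f`.
-/

namespace GCT

/-! ### Solving acyclic linear systems by determinants -/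

/-- A matrix `1 - N` is unipotent if the nonzero entries of `N` strictly decrease a rank. -/
theorem det_one_sub_eq_one_of_rank {V A : Type*} [Fintype V] [DecidableEq V] [CommRing A]
    (N : Matrix V V A) (rank : V → ℕ) (hN : ∀ v w, N v w ≠ 0 → rank w < rank v) :
    (1 - N).det = 1 := by
  rw [Matrix.det_apply', Finset.sum_eq_single 1]
  · have hdiag (v : V) : N v v = 0 := by
      by_contra h
      exact lt_irrefl _ (hN v v h)
    simp [hdiag]
  · intro τ _ hτ
    obtain ⟨v₀, hv₀⟩ : ∃ v, τ v ≠ v := by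
      by_contra! h
      exact hτ (Equiv.ext h)
    -- A permutation contributing to the determinant can only raise ranks, hence moves nothing.
    suffices ∃ v, (1 - N) (τ v) v = 0 by
      obtain ⟨v, hv⟩ := this
      exact (congrArg _ (Finset.prod_eq_zero (f := fun i => (1 - N) (τ i) i)
        (Finset.mem_univ v) hv)).trans (mul_zero _)
    by_contra! hne
    have hlt (v : V) (hv : τ v ≠ v) : rank v < rank (τ v) := by
      apply hN
      intro h
      apply hne v
      simp [h, hv]
    have hle (v : V) : rank v ≤ rank (τ v) := by
      by_cases hv : τ v = v
      · rw [hv]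
      · exact (hlt v hv).le
    have := Finset.sum_lt_sum (fun v _ => hle v) ⟨v₀, Finset.mem_univ _, hlt v₀ hv₀⟩
    rw [Equiv.sum_comp τ rank] at this
    exact lt_irrefl _ this
  · simp

/-- By Cramer's rule, a coordinate of the solution of a unipotent linear system is the determinant
of the system bordered by its right-hand side and by a unit vector. -/
theorem det_bordered_of_rank {V A : Type*} [Fintype V] [DecidableEq V] [CommRing A]
    (N : Matrix V V A) (rank : V → ℕ) (hN : ∀ v w, N v w ≠ 0 → rank w < rank v) (b x : V → A)
    (hx : ∀ v, x v = ∑ w, N v w * x w + b v) (o : V) :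
    (Matrix.fromBlocks (1 - N) (Matrix.of fun v (_ : Unit) => b v)
      (Matrix.of fun (_ : Unit) w => if w = o then -1 else 0) 0).det = x o := by
  have h : Matrix.fromBlocks (1 - N) (Matrix.of fun v (_ : Unit) => b v)
      (Matrix.of fun (_ : Unit) w => if w = o then -1 else 0) 0 *
      Matrix.fromBlocks 1 (Matrix.of fun v (_ : Unit) => -x v) 0 1 =
      Matrix.fromBlocks (1 - N) 0 (Matrix.of fun (_ : Unit) w => if w = o then -1 else 0)
        (Matrix.of fun (_ _ : Unit) => x o) := by
    rw [Matrix.fromBlocks_multiply]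
    congr 1
    · simp
    · ext v u
      simp only [Matrix.sub_mul, Matrix.one_mul, Matrix.mul_one, Matrix.add_apply,
        Matrix.sub_apply, Matrix.mul_apply, Matrix.of_apply, Matrix.zero_apply]
      rw [hx v]
      simp
    · simp
    · ext u u'
      simp [Matrix.mul_apply]
  have h' := congrArg Matrix.det h
  rw [Matrix.det_mul, Matrix.det_fromBlocks_zero₂₁, Matrix.det_fromBlocks_zero₁₂,
    det_one_sub_eq_one_of_rank N rank hN] at h'
  simpa using h'

/-! ### Separated subcircuits of a weakly-skew circuit -/

namespace ArithCircuit

variable {σ R V : Type*} (C : ArithCircuit σ R V)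

theorem InSubcircuit.refl {C : ArithCircuit σ R V} (v : V) : C.InSubcircuit v v :=
  Relation.ReflTransGen.refl

theorem InSubcircuit.trans {C : ArithCircuit σ R V} {u v w : V} (h : C.InSubcircuit u v)
    (h' : C.InSubcircuit v w) : C.InSubcircuit u w :=
  Relation.ReflTransGen.trans h h'

theorem Wire.inSubcircuit {C : ArithCircuit σ R V} {u v : V} {i : Fin 2} (h : C.Wire u i v) :
    C.InSubcircuit u v :=
  Relation.ReflTransGen.single ⟨i, h⟩

theorem Wire.not_inSubcircuit {C : ArithCircuit σ R V} {u v : V} {i : Fin 2} (h : C.Wire u i v) :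
    ¬ C.InSubcircuit v u := fun h' =>
  C.acyclic v (Relation.TransGen.tail' h' ⟨i, h⟩)

/-- A choice, for each multiplication gate `α` with operands `a`, of the index of an operand
`a (s α)` that is computed by a separate subcircuit. -/
def IsSeparating (s : V → Fin 2) : Prop :=
  ∀ (α : V) (a : Fin 2 → V), C.gate α = Gate.mul a →
    ∀ (u : V) (j : Fin 2) (v : V),
      C.InSubcircuit u (a (s α)) → ¬ C.InSubcircuit v (a (s α)) → C.Wire u j v →
        u = a (s α) ∧ j = s α ∧ v = α

theorem IsWeaklySkew.exists_isSeparating {C : ArithCircuit σ R V} (h : C.IsWeaklySkew) :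
    ∃ s, C.IsSeparating s := by
  have : ∀ α, ∃ i : Fin 2, ∀ a, C.gate α = Gate.mul a → ∀ (u : V) (j : Fin 2) (v : V),
      C.InSubcircuit u (a i) → ¬ C.InSubcircuit v (a i) → C.Wire u j v →
        u = a i ∧ j = i ∧ v = α := by
    intro α
    by_cases hα : ∃ a, C.gate α = Gate.mul a
    · obtain ⟨a, ha⟩ := hα
      obtain ⟨i, hi⟩ := h α a ha
      refine ⟨i, fun a' ha' => ?_⟩
      rw [ha, Gate.mul.injEq] at ha'
      exact ha' ▸ hi
    · exact ⟨0, fun a ha => (hα ⟨a, ha⟩).elim⟩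
  choose s hs using this
  exact ⟨s, hs⟩

/-- The `i`-th operand of a multiplication gate (and the vertex itself for other vertices). -/
def operand (α : V) (i : Fin 2) : V :=
  match C.gate α with
  | .mul a => a i
  | _ => α

/-- `α` is a multiplication gate, and `v` is a vertex of the subcircuit computing its separate
operand. -/
def Guards (s : V → Fin 2) (α v : V) : Prop :=
  (∃ a, C.gate α = Gate.mul a) ∧ C.InSubcircuit v (C.operand α (s α))

variable {C} {s : V → Fin 2}

theorem wire_operand {α : V} (h : ∃ a, C.gate α = Gate.mul a) (i : Fin 2) :
    C.Wire (C.operand α i) i α := by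
  obtain ⟨a, ha⟩ := h
  simp [Wire, operand, ha, Gate.HasOperand]

theorem Guards.not_inSubcircuit {α v : V} (h : C.Guards s α v) : ¬ C.InSubcircuit α v := fun h' =>
  (wire_operand h.1 (s α)).not_inSubcircuit (h'.trans h.2)

theorem Guards.of_inSubcircuit {α u v : V} (h : C.Guards s α v) (huv : C.InSubcircuit u v) :
    C.Guards s α u :=
  ⟨h.1, huv.trans h.2⟩

theorem guards_operand {α : V} (h : ∃ a, C.gate α = Gate.mul a) :
    C.Guards s α (C.operand α (s α)) :=
  ⟨h, .refl _⟩

/-- An edge leaving a separated subcircuit is the edge that leads to its multiplication gate. -/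
theorem Guards.of_wire (hs : C.IsSeparating s) {α u v : V} {j : Fin 2} (h : C.Guards s α u)
    (huv : C.Wire u j v) :
    C.Guards s α v ∨ u = C.operand α (s α) ∧ j = s α ∧ v = α := by
  by_cases hv : C.InSubcircuit v (C.operand α (s α))
  · exact .inl ⟨h.1, hv⟩
  · right
    obtain ⟨⟨a, ha⟩, hu⟩ := h
    have hop : C.operand α (s α) = a (s α) := by simp [operand, ha]
    rw [hop] at hu hv ⊢
    exact hs α a ha u j v hu hv huv

/-- A path that starts in a separated subcircuit stays there or passes through its multiplication
gate. -/
theorem Guards.of_path (hs : C.IsSeparating s) {α u w : V} (h : C.Guards s α u)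
    (huw : C.InSubcircuit u w) : C.Guards s α w ∨ C.InSubcircuit α w := by
  induction huw with
  | refl => exact .inl h
  | tail _ hw ih =>
    obtain ⟨j, hj⟩ := hw
    rcases ih with ih | ih
    · rcases ih.of_wire hs hj with h' | ⟨-, -, rfl⟩
      · exact .inl h'
      · exact .inr (.refl _)
    · exact .inr (ih.trans (Wire.inSubcircuit hj))

variable [Fintype V]

open Classical in
/-- The multiplication gates whose separated subcircuits contain `v`. -/
noncomputable def guards (C : ArithCircuit σ R V) (s : V → Fin 2) (v : V) : Finset V :=
  Finset.univ.filter fun α => C.Guards s α v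

theorem mem_guards {α v : V} : α ∈ C.guards s v ↔ C.Guards s α v := by
  simp [guards]

theorem guards_of_add (hs : C.IsSeparating s) {v : V} {a : Fin 2 → V}
    (hv : C.gate v = Gate.add a) (j : Fin 2) : C.guards s (a j) = C.guards s v := by
  have hw : C.Wire (a j) j v := by simp [Wire, hv, Gate.HasOperand]
  ext α
  simp only [mem_guards]
  refine ⟨fun h => ?_, fun h => h.of_inSubcircuit hw.inSubcircuit⟩
  rcases h.of_wire hs hw with h' | ⟨-, -, rfl⟩
  · exact h'
  · obtain ⟨⟨a', ha'⟩, -⟩ := h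
    simp [hv] at ha'

theorem guards_operand_other (hs : C.IsSeparating s) {α : V} (hα : ∃ a, C.gate α = Gate.mul a) :
    C.guards s (C.operand α (s α).rev) = C.guards s α := by
  have hw := wire_operand hα (s α).rev
  ext α'
  simp only [mem_guards]
  refine ⟨fun h => ?_, fun h => h.of_inSubcircuit hw.inSubcircuit⟩
  rcases h.of_wire hs hw with h' | ⟨-, h2, rfl⟩
  · exact h'
  · exact absurd h2 (by generalize s α = i; revert i; decide)

theorem notMem_guards_self (α : V) : α ∉ C.guards s α := fun h =>
  (mem_guards.1 h).not_inSubcircuit (.refl _)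

theorem guards_operand_separate [DecidableEq V] (hs : C.IsSeparating s) {α : V}
    (hα : ∃ a, C.gate α = Gate.mul a) :
    C.guards s (C.operand α (s α)) = insert α (C.guards s α) := by
  have hw := wire_operand hα (s α)
  ext α'
  simp only [mem_guards, Finset.mem_insert]
  constructor
  · intro h
    rcases h.of_wire hs hw with h' | ⟨-, -, rfl⟩
    · exact .inr h'
    · exact .inl rfl
  · rintro (rfl | h)
    · exact guards_operand hα
    · exact h.of_inSubcircuit hw.inSubcircuit

theorem guards_output : C.guards s C.output = ∅ := by
  ext α
  simp only [mem_guards, Finset.notMem_empty, iff_false]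
  rintro ⟨hα, h⟩
  have hno := (C.outdegree_eq_zero_iff C.output).2 rfl
  have h' := h.trans (wire_operand hα (s α)).inSubcircuit
  rcases Relation.ReflTransGen.cases_head h' with heq | ⟨w, ⟨i, hi⟩, -⟩
  · rcases Relation.ReflTransGen.cases_head h with heq' | ⟨w, ⟨i, hi⟩, -⟩
    · exact hno _ _ (heq' ▸ wire_operand hα (s α))
    · exact hno w i hi
  · exact hno w i hi

/-- Separated subcircuits are nested or disjoint, so that a vertex `v` contained in some of them is
contained in an innermost one: its separate operand lies in exactly the same separated
subcircuits as `v`. -/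
theorem exists_innermost (hs : C.IsSeparating s) {v : V} (hv : (C.guards s v).Nonempty) :
    ∃ α, C.Guards s α v ∧ C.guards s v = C.guards s (C.operand α (s α)) := by
  -- A gate is innermost if its separate operand lies in as many separated subcircuits as possible.
  obtain ⟨α, hα, hmax⟩ := Finset.exists_max_image (C.guards s v)
    (fun α => (C.guards s (C.operand α (s α))).card) hv
  have hα' := mem_guards.1 hα
  refine ⟨α, hα', Finset.Subset.antisymm ?_ ?_⟩
  · intro α' h
    have h' := mem_guards.1 h
    rcases hα'.of_path hs h'.2 with hc | hc
    · have hsub : C.guards s (C.operand α (s α)) ⊆ C.guards s (C.operand α' (s α')) := by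
        intro α'' h''
        exact mem_guards.2 ((mem_guards.1 h'').of_inSubcircuit hc.2)
      rw [Finset.eq_of_subset_of_card_le hsub (hmax α' h)]
      exact mem_guards.2 (guards_operand h'.1)
    · exact mem_guards.2 ⟨h'.1, (wire_operand hα'.1 (s α)).inSubcircuit.trans hc⟩
  · intro α' h
    exact mem_guards.2 ((mem_guards.1 h).of_inSubcircuit hα'.2)

theorem Guards.not_inSubcircuit_other (hs : C.IsSeparating s) {α v : V} (h : C.Guards s α v) :
    ¬ C.InSubcircuit v (C.operand α (s α).rev) := by
  intro hv
  rcases h.of_path hs hv with h' | h'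
  · have := mem_guards.2 h'
    rw [guards_operand_other hs h.1] at this
    exact notMem_guards_self α this
  · exact (wire_operand h.1 _).not_inSubcircuit h'

open Classical in
/-- The vertices that have to be evaluated before `v`, if a separated subcircuit is evaluated only
after the other operand of its multiplication gate. -/
noncomputable def precursors (C : ArithCircuit σ R V) (s : V → Fin 2) (v : V) : Finset V :=
  Finset.univ.filter fun u => C.InSubcircuit u v ∨
    ∃ α, C.Guards s α v ∧ C.InSubcircuit u (C.operand α (s α).rev)

theorem mem_precursors {u v : V} : u ∈ C.precursors s v ↔ C.InSubcircuit u v ∨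
    ∃ α, C.Guards s α v ∧ C.InSubcircuit u (C.operand α (s α).rev) := by
  simp [precursors]

theorem card_precursors_add (hs : C.IsSeparating s) {v : V} {a : Fin 2 → V}
    (hv : C.gate v = Gate.add a) (j : Fin 2) :
    (C.precursors s (a j)).card < (C.precursors s v).card := by
  have hw : C.Wire (a j) j v := by simp [Wire, hv, Gate.HasOperand]
  have hg (α : V) : C.Guards s α (a j) ↔ C.Guards s α v := by
    rw [← mem_guards, guards_of_add hs hv, mem_guards]
  apply Finset.card_lt_card
  refine Finset.ssubset_iff_of_subset ?_ |>.2 ⟨v, mem_precursors.2 (.inl (.refl v)), ?_⟩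
  · intro u hu
    rw [mem_precursors] at hu ⊢
    rcases hu with hu | ⟨α, hα, hu⟩
    · exact .inl (hu.trans hw.inSubcircuit)
    · exact .inr ⟨α, (hg α).1 hα, hu⟩
  · rw [mem_precursors]
    rintro (h | ⟨α, hα, h⟩)
    · exact hw.not_inSubcircuit h
    · exact ((hg α).1 hα).not_inSubcircuit_other hs h

theorem card_precursors_mul (hs : C.IsSeparating s) {α : V} (hα : ∃ a, C.gate α = Gate.mul a) :
    (C.precursors s (C.operand α (s α))).card < (C.precursors s α).card := by
  have hw := wire_operand hα
  have hg (α' : V) : C.Guards s α' (C.operand α (s α)) ↔ α' = α ∨ C.Guards s α' α := by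
    classical
    rw [← mem_guards, guards_operand_separate hs hα, Finset.mem_insert, mem_guards]
  apply Finset.card_lt_card
  refine Finset.ssubset_iff_of_subset ?_ |>.2 ⟨α, mem_precursors.2 (.inl (.refl α)), ?_⟩
  · intro u hu
    rw [mem_precursors] at hu ⊢
    rcases hu with hu | ⟨α', hα', hu⟩
    · exact .inl (hu.trans (hw _).inSubcircuit)
    · rcases (hg α').1 hα' with rfl | h'
      · exact .inl (hu.trans (hw _).inSubcircuit)
      · exact .inr ⟨α', h', hu⟩
  · rw [mem_precursors]
    rintro (h | ⟨α', hα', h⟩)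
    · exact (hw _).not_inSubcircuit h
    · rcases (hg α').1 hα' with rfl | h'
      · exact (hw _).not_inSubcircuit h
      · exact h'.not_inSubcircuit_other hs h

theorem card_precursors_innermost (hs : C.IsSeparating s) {α v : V} (hα : C.Guards s α v)
    (hv : C.guards s v = C.guards s (C.operand α (s α))) :
    (C.precursors s (C.operand α (s α).rev)).card < (C.precursors s v).card := by
  have hg (α' : V) (h : C.Guards s α' (C.operand α (s α).rev)) : C.Guards s α' v := by
    classical
    rw [← mem_guards, guards_operand_other hs hα.1] at h
    rw [← mem_guards, hv, guards_operand_separate hs hα.1]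
    exact Finset.mem_insert_of_mem h
  apply Finset.card_lt_card
  refine Finset.ssubset_iff_of_subset ?_ |>.2 ⟨v, mem_precursors.2 (.inl (.refl v)), ?_⟩
  · intro u hu
    rw [mem_precursors] at hu ⊢
    rcases hu with hu | ⟨α', hα', hu⟩
    · exact .inr ⟨α, hα, hu⟩
    · exact .inr ⟨α', hg α' hα', hu⟩
  · rw [mem_precursors]
    rintro (h | ⟨α', hα', h⟩)
    · exact hα.not_inSubcircuit_other hs h
    · exact (hg α' hα').not_inSubcircuit_other hs h

end ArithCircuit

/-! ### Weakly-skew circuits compute determinants -/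

/-- The affine linear polynomials `c + ∑ i, a i * X i`. -/
noncomputable def affineForms : Submodule ℂ (MvPolynomial ℕ ℂ) :=
  Submodule.span ℂ (insert 1 (Set.range MvPolynomial.X))

theorem one_mem_affineForms : 1 ∈ affineForms :=
  Submodule.subset_span (Set.mem_insert _ _)

theorem C_mem_affineForms (c : ℂ) : MvPolynomial.C c ∈ affineForms := by
  rw [← mul_one (MvPolynomial.C c), ← MvPolynomial.smul_eq_C_mul]
  exact Submodule.smul_mem _ _ one_mem_affineForms

theorem X_mem_affineForms (i : ℕ) : MvPolynomial.X i ∈ affineForms :=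
  Submodule.subset_span (Set.mem_insert_of_mem _ ⟨i, rfl⟩)

namespace ArithCircuit

/-- A polynomial computed by a weakly-skew circuit is the determinant of a matrix of affine linear
polynomials. The unknowns of the underlying linear system are the values of the vertices, each
multiplied by the values of the other operands of all multiplication gates that guard it. -/
theorem IsWeaklySkew.exists_det {V : Type*} [Fintype V] [DecidableEq V]
    {C : ArithCircuit ℕ ℂ V} (hC : C.IsWeaklySkew) {f : MvPolynomial ℕ ℂ} (hf : C.Computes f) :
    ∃ M : Matrix (V ⊕ Unit) (V ⊕ Unit) (MvPolynomial ℕ ℂ),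
      (∀ i j, M i j ∈ affineForms) ∧ M.det = f := by
  obtain ⟨val, hval, hout⟩ := hf
  obtain ⟨s, hs⟩ := hC.exists_isSeparating
  set x : V → MvPolynomial ℕ ℂ := fun v =>
    val v * ∏ α ∈ C.guards s v, val (C.operand α (s α).rev) with hx
  set rank : V → ℕ := fun v => (C.precursors s v).card with hrank
  have hleaf (v : V) (l : MvPolynomial ℕ ℂ) (hl : l ∈ affineForms) (hvl : val v = l) :
      ∃ (N : V → MvPolynomial ℕ ℂ) (b : MvPolynomial ℕ ℂ), (∀ w, N w ∈ affineForms) ∧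
        b ∈ affineForms ∧ (∀ w, N w ≠ 0 → rank w < rank v) ∧ x v = ∑ w, N w * x w + b := by
    rcases (C.guards s v).eq_empty_or_nonempty with hemp | hne
    · refine ⟨0, l, fun _ => Submodule.zero_mem _, hl, fun _ h => absurd rfl h, ?_⟩
      simp [hx, hemp, hvl]
    · obtain ⟨α, hα, hg⟩ := exists_innermost hs hne
      refine ⟨Pi.single (C.operand α (s α).rev) l, 0, fun w => ?_, Submodule.zero_mem _,
        fun w hw => ?_, ?_⟩
      · rw [Pi.single_apply]
        split_ifs
        exacts [hl, Submodule.zero_mem _]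
      · have : w = C.operand α (s α).rev := by
          by_contra h
          exact hw (Pi.single_eq_of_ne h _)
        rw [this]
        exact card_precursors_innermost hs hα hg
      · simp only [Pi.single_apply, ite_mul, zero_mul, Finset.sum_ite_eq', Finset.mem_univ,
          if_true, add_zero, hx]
        rw [hg, guards_operand_separate hs hα.1, Finset.prod_insert (notMem_guards_self α),
          guards_operand_other hs hα.1, hvl]
  have hrow (v : V) : ∃ (N : V → MvPolynomial ℕ ℂ) (b : MvPolynomial ℕ ℂ),
      (∀ w, N w ∈ affineForms) ∧ b ∈ affineForms ∧ (∀ w, N w ≠ 0 → rank w < rank v) ∧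
        x v = ∑ w, N w * x w + b := by
    cases hv : C.gate v with
    | const c => exact hleaf v _ (C_mem_affineForms c) (by rw [hval v, hv]; rfl)
    | var i => exact hleaf v _ (X_mem_affineForms i) (by rw [hval v, hv]; rfl)
    | add a =>
      refine ⟨fun w => (if w = a 0 then 1 else 0) + if w = a 1 then 1 else 0, 0, fun w => ?_,
        Submodule.zero_mem _, fun w hw => ?_, ?_⟩
      · refine Submodule.add_mem _ ?_ ?_ <;> split_ifs <;>
          first | exact one_mem_affineForms | exact Submodule.zero_mem _
      · by_cases h0 : w = a 0
        · rw [h0]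
          exact card_precursors_add hs hv 0
        · by_cases h1 : w = a 1
          · rw [h1]
            exact card_precursors_add hs hv 1
          · simp [h0, h1] at hw
      · simp only [add_mul, ite_mul, one_mul, zero_mul, Finset.sum_add_distrib,
          Finset.sum_ite_eq', Finset.mem_univ, if_true, add_zero, hx]
        rw [guards_of_add hs hv, guards_of_add hs hv, ← add_mul]
        congr 1
        rw [hval v, hv]
        rfl
    | mul a =>
      have hα : ∃ a, C.gate v = Gate.mul a := ⟨a, hv⟩
      refine ⟨Pi.single (C.operand v (s v)) 1, 0, fun w => ?_, Submodule.zero_mem _,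
        fun w hw => ?_, ?_⟩
      · rw [Pi.single_apply]
        split_ifs
        exacts [one_mem_affineForms, Submodule.zero_mem _]
      · have : w = C.operand v (s v) := by
          by_contra h
          exact hw (Pi.single_eq_of_ne h _)
        rw [this]
        exact card_precursors_mul hs hα
      · simp only [Pi.single_apply, ite_mul, zero_mul, one_mul, Finset.sum_ite_eq',
          Finset.mem_univ, if_true, add_zero, hx]
        rw [guards_operand_separate hs hα, Finset.prod_insert (notMem_guards_self v), ← mul_assoc]
        congr 1
        have hop (i : Fin 2) : C.operand v i = a i := by simp [operand, hv]
        rw [hval v, hv, hop, hop]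
        simp only [Gate.value]
        generalize s v = i
        fin_cases i
        · rfl
        · exact mul_comm _ _
  choose N b hN hb hrk hsys using hrow
  refine ⟨_, ?_, (det_bordered_of_rank (Matrix.of N) rank hrk b x hsys C.output).trans ?_⟩
  · rintro (v | u) (w | u')
    · simp only [Matrix.fromBlocks_apply₁₁, Matrix.sub_apply, Matrix.of_apply]
      refine Submodule.sub_mem _ ?_ (hN v w)
      rw [Matrix.one_apply]
      split_ifs
      exacts [one_mem_affineForms, Submodule.zero_mem _]
    · exact hb v
    · simp only [Matrix.fromBlocks_apply₂₁, Matrix.of_apply]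
      split_ifs
      exacts [Submodule.neg_mem _ one_mem_affineForms, Submodule.zero_mem _]
    · exact Submodule.zero_mem _
  · simp [hx, guards_output, hout]

end ArithCircuit

/-- The variables of a polynomial computed by a circuit are among the labels of its vertices. -/
theorem ArithCircuit.Computes.card_vars_le {σ R V : Type*} [CommSemiring R] [Fintype V]
    {C : ArithCircuit σ R V} {f : MvPolynomial σ R} (hf : C.Computes f) :
    f.vars.card ≤ Fintype.card V := by
  classical
  obtain ⟨val, hval, rfl⟩ := hf
  have hsub (v : V) : ∀ i ∈ (val v).vars, ∃ w, C.gate w = Gate.var i := by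
    induction v using C.wellFounded_wire.induction with
    | _ v ih =>
      intro i hi
      rw [hval v] at hi
      cases hv : C.gate v with
      | const c => simp [hv, Gate.value] at hi
      | var j =>
        rw [hv, Gate.value] at hi
        rw [MvPolynomial.mem_vars_iff_mem_support] at hi
        obtain ⟨d, hd, hid⟩ := hi
        have hd' := MvPolynomial.support_monomial_subset hd
        have hij : i = j := by simpa [Finset.mem_singleton.1 hd'] using hid
        exact ⟨v, hij ▸ hv⟩
      | add a =>
        rw [hv, Gate.value] at hi
        rcases Finset.mem_union.1 (MvPolynomial.vars_add_subset _ _ hi) with h | h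
        · exact ih (a 0) ⟨0, by simp [Wire, hv, Gate.HasOperand]⟩ i h
        · exact ih (a 1) ⟨1, by simp [Wire, hv, Gate.HasOperand]⟩ i h
      | mul a =>
        rw [hv, Gate.value] at hi
        rcases Finset.mem_union.1 (MvPolynomial.vars_mul _ _ hi) with h | h
        · exact ih (a 0) ⟨0, by simp [Wire, hv, Gate.HasOperand]⟩ i h
        · exact ih (a 1) ⟨1, by simp [Wire, hv, Gate.HasOperand]⟩ i h
  have : Nonempty V := ⟨C.output⟩
  choose! w hw using hsub C.output
  refine (Finset.card_le_card_of_injOn w (fun _ _ => Finset.mem_univ _) ?_).trans_eq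
    Finset.card_univ
  intro i hi j hj hij
  have := (hw i hi).symm.trans (hij ▸ hw j hj)
  simpa using this

/-- Padding by an identity block turns a circuit of size at most `r` into a determinant of size
exactly `r + 1`. -/
theorem exists_det_of_Lws_le {g : MvPolynomial ℕ ℂ} {r : ℕ} (hg : Lws g ≤ r) :
    g.vars.card ≤ r ∧ ∃ M : Matrix (Fin (r + 1)) (Fin (r + 1)) (MvPolynomial ℕ ℂ),
      (∀ i j, M i j ∈ affineForms) ∧ M.det = g := by
  have hne : {s : ℕ∞ | ∃ (V : Type) (_ : Fintype V) (C : ArithCircuit ℕ ℂ V),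
      C.IsWeaklySkew ∧ C.Computes g ∧ (Fintype.card V : ℕ∞) = s}.Nonempty := by
    by_contra h
    rw [Lws, Set.not_nonempty_iff_eq_empty.1 h, sInf_empty] at hg
    exact absurd hg (by simp)
  obtain ⟨V, _, C, hC, hCg, hcard⟩ := csInf_mem hne
  have hVr : Fintype.card V ≤ r := by
    rw [← Lws] at hcard
    rw [← hcard] at hg
    exact_mod_cast hg
  refine ⟨hCg.card_vars_le.trans hVr, ?_⟩
  classical
  obtain ⟨M, hM, hdet⟩ := hC.exists_det hCg
  have e : (V ⊕ Unit) ⊕ Fin (r - Fintype.card V) ≃ Fin (r + 1) :=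
    Fintype.equivFinOfCardEq (by simp; omega)
  refine ⟨(Matrix.fromBlocks M 0 0 1).submatrix e.symm e.symm, fun i j => ?_, ?_⟩
  · rw [Matrix.submatrix_apply]
    rcases e.symm i with i' | i' <;> rcases e.symm j with j' | j'
    · exact hM i' j'
    · exact Submodule.zero_mem _
    · exact Submodule.zero_mem _
    · rw [Matrix.fromBlocks_apply₂₂, Matrix.one_apply]
      split_ifs
      exacts [one_mem_affineForms, Submodule.zero_mem _]
  · rw [Matrix.det_submatrix_equiv_self, Matrix.det_fromBlocks_zero₂₁, hdet, Matrix.det_one,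
      mul_one]

/-! ### Skew straight-line programs -/

/-- A family of labelled vertices, all of whose wires increase a rank and in which the first operand
of each multiplication gate is an input without further use, contains a weakly-skew circuit for
each of its vertices: the subcircuit of all vertices from which that vertex can be reached. -/
theorem Lws_le_card_of_gates {V : Type} [Fintype V] (gate : V → Gate ℕ ℂ V) (rank : V → ℕ)
    (hrank : ∀ u i v, (gate v).HasOperand i u → rank u < rank v)
    (hskew : ∀ α a, gate α = Gate.mul a → (∀ i u, ¬ (gate (a 0)).HasOperand i u) ∧
      ∀ j v, (gate v).HasOperand j (a 0) → j = 0 ∧ v = α)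
    (val : V → MvPolynomial ℕ ℂ) (hval : ∀ v, val v = (gate v).value val) (o : V) :
    Lws (val o) ≤ Fintype.card V := by
  classical
  let reach : V → V → Prop := Relation.ReflTransGen fun u w => ∃ i, (gate w).HasOperand i u
  let W : Type := {v : V // reach v o}
  have hstep (v : V) (hv : reach v o) (i : Fin 2) (u : V) (h : (gate v).HasOperand i u) :
      reach u o := Relation.ReflTransGen.head ⟨i, h⟩ hv
  have hgate (v : W) : ∃ g : Gate ℕ ℂ W,
      (∀ i (u : W), g.HasOperand i u ↔ (gate v.1).HasOperand i u.1) ∧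
      g.value (fun u => val u.1) = (gate v.1).value val ∧
      ∀ a, g = Gate.mul a → gate v.1 = Gate.mul fun i => (a i).1 := by
    obtain ⟨v, hv⟩ := v
    have hs := hstep v hv
    dsimp only
    cases hg : gate v with
    | const c => exact ⟨.const c, fun i u => Iff.rfl, rfl, by simp⟩
    | var c => exact ⟨.var c, fun i u => Iff.rfl, rfl, by simp⟩
    | add a =>
      rw [hg] at hs
      exact ⟨.add fun i => ⟨a i, hs i (a i) rfl⟩, fun i u => Subtype.ext_iff, rfl, by simp⟩
    | mul a =>
      rw [hg] at hs
      refine ⟨.mul fun i => ⟨a i, hs i (a i) rfl⟩, fun i u => Subtype.ext_iff, rfl, ?_⟩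
      rintro b hb
      rw [Gate.mul.injEq] at hb
      rw [← hb]
  choose g hg₁ hg₂ hg₃ using hgate
  have hlt {u v : W} (h : Relation.TransGen (fun u w => ∃ i, (g w).HasOperand i u) u v) :
      rank u.1 < rank v.1 := by
    induction h with
    | single h =>
      obtain ⟨i, h⟩ := h
      exact hrank _ i _ ((hg₁ _ i _).1 h)
    | tail _ h ih =>
      obtain ⟨i, h⟩ := h
      exact ih.trans (hrank _ i _ ((hg₁ _ i _).1 h))
  have hle {u v : V} (h : reach u v) : rank u ≤ rank v := by
    induction h with
    | refl => exact le_rfl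
    | tail _ h ih =>
      obtain ⟨i, h⟩ := h
      exact ih.trans (hrank _ i _ h).le
  let C : ArithCircuit ℕ ℂ W :=
    { gate := g
      acyclic := fun v h => lt_irrefl _ (hlt h)
      output := ⟨o, Relation.ReflTransGen.refl⟩
      outdegree_eq_zero_iff := by
        rintro ⟨u, hu⟩
        constructor
        · intro h
          rcases Relation.ReflTransGen.cases_head hu with heq | ⟨w, ⟨i, hi⟩, hw⟩
          · exact Subtype.ext heq
          · exact absurd ((hg₁ ⟨w, hw⟩ i ⟨u, hu⟩).2 hi) (h _ _)
        · intro h w i hi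
          have h1 := hrank _ i _ ((hg₁ w i _).1 hi)
          have h2 : u = o := congrArg Subtype.val h
          exact absurd (hle w.2) (not_le.2 (h2 ▸ h1)) }
  have hws : C.IsWeaklySkew := by
    intro α a ha
    obtain ⟨hleaf, huse⟩ := hskew α.1 _ (hg₃ α a ha)
    refine ⟨0, fun u j v hu _ hw => ?_⟩
    have hu' : u = a 0 := by
      rcases Relation.ReflTransGen.cases_tail hu with h | ⟨w, -, ⟨i, hi⟩⟩
      · exact h.symm
      · exact absurd ((hg₁ _ i _).1 hi) (hleaf _ _)
    subst hu'
    obtain ⟨h1, h2⟩ := huse j v.1 ((hg₁ v j _).1 hw)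
    exact ⟨rfl, h1, Subtype.ext h2⟩
  have hcomp : C.Computes (val o) :=
    ⟨fun u => val u.1, fun v => (hval v.1).trans (hg₂ v).symm, rfl⟩
  have hmem : ((Fintype.card W : ℕ) : ℕ∞) ∈ {s : ℕ∞ | ∃ (V : Type) (_ : Fintype V)
      (C : ArithCircuit ℕ ℂ V), C.IsWeaklySkew ∧ C.Computes (val o) ∧ (Fintype.card V : ℕ∞) = s} :=
    ⟨W, inferInstance, C, hws, hcomp, rfl⟩
  refine (sInf_le hmem).trans ?_
  exact_mod_cast Fintype.card_subtype_le _

/-- The polynomials labelling the inputs of a circuit. -/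
def IsInput (p : MvPolynomial ℕ ℂ) : Prop :=
  (∃ c, p = MvPolynomial.C c) ∨ ∃ i, p = MvPolynomial.X i

/-- The polynomials `val 0, …, val (T - 1)` are the successive results of a straight-line program
in which one factor of each product is an input. -/
def IsSkewProgram (T : ℕ) (val : ℕ → MvPolynomial ℕ ℂ) : Prop :=
  ∀ k < T, IsInput (val k) ∨ (∃ i < k, ∃ j < k, val k = val i + val j) ∨
    ∃ i < k, ∃ l, IsInput l ∧ val k = l * val i

theorem IsInput.exists_gate {p : MvPolynomial ℕ ℂ} (hp : IsInput p) (V : Type) :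
    ∃ g : Gate ℕ ℂ V, (∀ i u, ¬ g.HasOperand i u) ∧ (∀ w, g.value w = p) ∧
      ∀ a, g ≠ Gate.mul a := by
  rcases hp with ⟨c, rfl⟩ | ⟨i, rfl⟩
  · exact ⟨.const c, fun _ _ h => h, fun _ => rfl, by simp⟩
  · exact ⟨.var i, fun _ _ h => h, fun _ => rfl, by simp⟩

/-- In a circuit, the input factor of each product of a skew program gets a vertex of its own. -/
theorem IsSkewProgram.Lws_le {T : ℕ} {val : ℕ → MvPolynomial ℕ ℂ} (h : IsSkewProgram T val)
    {k : ℕ} (hk : k < T) : Lws (val k) ≤ (2 * T : ℕ) := by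
  let V : Type := Fin T × Bool
  have key (k : Fin T) : ∃ (p : MvPolynomial ℕ ℂ) (l g : Gate ℕ ℂ V),
      (∀ i u, ¬ l.HasOperand i u) ∧ (∀ w, l.value w = p) ∧ (∀ a, l ≠ Gate.mul a) ∧
      (∀ w : V → MvPolynomial ℕ ℂ, w (k, true) = p → (∀ i, w (i, false) = val i) →
        g.value w = val k) ∧
      (∀ i u, g.HasOperand i u → (u = (k, true) ∧ i = 0) ∨ ∃ j < k, u = (j, false)) ∧
      ∀ a, g = Gate.mul a → a 0 = (k, true) := by
    obtain ⟨k, hk⟩ := k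
    have h0 : IsInput 0 := .inl ⟨0, by simp⟩
    rcases h k hk with h | ⟨i, hi, j, hj, hij⟩ | ⟨i, hi, p, hp, hip⟩
    · obtain ⟨l, hl₁, hl₂, hl₃⟩ := h0.exists_gate V
      obtain ⟨g, hg₁, hg₂, hg₃⟩ := h.exists_gate V
      exact ⟨0, l, g, hl₁, hl₂, hl₃, fun w _ _ => hg₂ w, fun i u h => (hg₁ i u h).elim,
        fun a ha => (hg₃ a ha).elim⟩
    · obtain ⟨l, hl₁, hl₂, hl₃⟩ := h0.exists_gate V
      refine ⟨0, l, .add ![(⟨i, hi.trans hk⟩, false), (⟨j, hj.trans hk⟩, false)], hl₁, hl₂, hl₃,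
        fun w _ hw => ?_, fun n u hu => .inr ?_, by simp⟩
      · simp [Gate.value, hw, hij]
      · simp only [Gate.HasOperand] at hu
        fin_cases n
        · exact ⟨⟨i, hi.trans hk⟩, hi, hu.symm⟩
        · exact ⟨⟨j, hj.trans hk⟩, hj, hu.symm⟩
    · obtain ⟨l, hl₁, hl₂, hl₃⟩ := hp.exists_gate V
      refine ⟨p, l, .mul ![(⟨k, hk⟩, true), (⟨i, hi.trans hk⟩, false)], hl₁, hl₂, hl₃,
        fun w hw₁ hw => ?_, fun n u hu => ?_, fun a ha => ?_⟩
      · simp [Gate.value, hw, hw₁, hip]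
      · simp only [Gate.HasOperand] at hu
        fin_cases n
        · exact .inl ⟨hu.symm, rfl⟩
        · exact .inr ⟨⟨i, hi.trans hk⟩, hi, hu.symm⟩
      · rw [Gate.mul.injEq] at ha
        rw [← ha]
        rfl
  choose p l g hl₁ hl₂ hl₃ hg₁ hg₂ hg₃ using key
  have hmain := Lws_le_card_of_gates (V := V) (fun v => if v.2 then l v.1 else g v.1)
    (fun v => if v.2 then 0 else v.1.1 + 1) ?_ ?_ (fun v => if v.2 then p v.1 else val v.1) ?_
    (⟨k, hk⟩, false)
  · simpa [V, mul_comm] using hmain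
  · rintro u i ⟨v, b⟩ hu
    cases b with
    | true => exact (hl₁ v i u (by simpa using hu)).elim
    | false =>
      rcases hg₂ v i u (by simpa using hu) with ⟨rfl, -⟩ | ⟨j, hj, rfl⟩
      · simp
      · simpa using hj
  · rintro ⟨α, b⟩ a ha
    cases b with
    | true => exact (hl₃ α a (by simpa using ha)).elim
    | false =>
      have h0 := hg₃ α a (by simpa using ha)
      rw [h0]
      refine ⟨fun i u hu => hl₁ α i u (by simpa using hu), ?_⟩
      rintro j ⟨v, b⟩ hv
      cases b with
      | true => exact (hl₁ v j _ (by simpa using hv)).elim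
      | false =>
        rcases hg₂ v j _ (by simpa using hv) with ⟨h1, h2⟩ | ⟨j, hj, h1⟩
        · exact ⟨h2, Prod.ext (congrArg Prod.fst h1).symm rfl⟩
        · exact absurd (congrArg Prod.snd h1) (by simp)
  · rintro ⟨v, b⟩
    cases b with
    | true => simp [hl₂]
    | false => simpa using (hg₁ v _ (by simp) (by simp)).symm

/-- Some skew program with `T` instructions computes all polynomials of the set `S`. -/
def SkewComputable (T : ℕ) (S : Set (MvPolynomial ℕ ℂ)) : Prop :=
  ∃ val, IsSkewProgram T val ∧ ∀ p ∈ S, ∃ k < T, val k = p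

theorem SkewComputable.Lws_le {T : ℕ} {S : Set (MvPolynomial ℕ ℂ)} (h : SkewComputable T S)
    {p : MvPolynomial ℕ ℂ} (hp : p ∈ S) : Lws p ≤ (2 * T : ℕ) := by
  obtain ⟨val, hval, hS⟩ := h
  obtain ⟨k, hk, rfl⟩ := hS p hp
  exact hval.Lws_le hk

theorem skewComputable_empty : SkewComputable 0 ∅ :=
  ⟨0, fun _ h => absurd h (Nat.not_lt_zero _), fun _ h => h.elim⟩

theorem SkewComputable.snoc {T : ℕ} {S : Set (MvPolynomial ℕ ℂ)} (h : SkewComputable T S)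
    {p : MvPolynomial ℕ ℂ} (hp : IsInput p ∨ (∃ q ∈ S, ∃ r ∈ S, p = q + r) ∨
      ∃ q ∈ S, ∃ l, IsInput l ∧ p = l * q) : SkewComputable (T + 1) (insert p S) := by
  obtain ⟨val, hval, hS⟩ := h
  have hold (i : ℕ) (hi : i < T) : Function.update val T p i = val i :=
    Function.update_of_ne hi.ne _ _
  refine ⟨Function.update val T p, fun k hk => ?_, ?_⟩
  · rcases Nat.lt_succ_iff_lt_or_eq.1 hk with hk | rfl
    · rw [hold k hk]
      rcases hval k hk with h | ⟨i, hi, j, hj, h⟩ | ⟨i, hi, l, hl, h⟩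
      · exact .inl h
      · exact .inr (.inl ⟨i, hi, j, hj, by rw [hold i (hi.trans hk), hold j (hj.trans hk), h]⟩)
      · exact .inr (.inr ⟨i, hi, l, hl, by rw [hold i (hi.trans hk), h]⟩)
    · rw [Function.update_self]
      rcases hp with h | ⟨q, hq, r, hr, h⟩ | ⟨q, hq, l, hl, h⟩
      · exact .inl h
      · obtain ⟨i, hi, rfl⟩ := hS q hq
        obtain ⟨j, hj, rfl⟩ := hS r hr
        exact .inr (.inl ⟨i, hi, j, hj, by rw [hold i hi, hold j hj, h]⟩)
      · obtain ⟨i, hi, rfl⟩ := hS q hq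
        exact .inr (.inr ⟨i, hi, l, hl, by rw [hold i hi, h]⟩)
  · rintro q (rfl | hq)
    · exact ⟨T, Nat.lt_succ_self T, Function.update_self _ _ _⟩
    · obtain ⟨k, hk, rfl⟩ := hS q hq
      exact ⟨k, hk.trans (Nat.lt_succ_self T), hold k hk⟩

/-- Once the polynomials of `S` have been computed, `c` further instructions of a skew program
suffice to compute the polynomials of `Q`. -/
def SkewCost (S Q : Set (MvPolynomial ℕ ℂ)) (c : ℕ) : Prop :=
  ∀ (T : ℕ) (S' : Set (MvPolynomial ℕ ℂ)), S ⊆ S' → SkewComputable T S' →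
    SkewComputable (T + c) (S' ∪ Q)

namespace SkewCost

variable {S S' Q Q' : Set (MvPolynomial ℕ ℂ)} {c c' : ℕ}

theorem Lws_le (h : SkewCost ∅ Q c) {p : MvPolynomial ℕ ℂ} (hp : p ∈ Q) :
    Lws p ≤ (2 * c : ℕ) := by
  have := (h 0 ∅ subset_rfl skewComputable_empty).Lws_le (.inr hp)
  rwa [zero_add] at this

theorem mono (h : SkewCost S Q c) (hS : S ⊆ S') (hQ : Q' ⊆ Q) : SkewCost S' Q' c := by
  intro T S'' hS'' hc
  obtain ⟨val, hval, hmem⟩ := h T S'' (hS.trans hS'') hc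
  exact ⟨val, hval, fun p hp => hmem p (Set.union_subset_union_right _ hQ hp)⟩

theorem trans (h : SkewCost S Q c) (h' : SkewCost (S ∪ Q) Q' c') :
    SkewCost S (Q ∪ Q') (c + c') := by
  intro T S'' hS hc
  rw [← add_assoc, ← Set.union_assoc]
  exact h' _ _ (Set.union_subset_union_left _ hS) (h T S'' hS hc)

theorem of_subset (h : Q ⊆ S) : SkewCost S Q 0 := by
  intro T S' hS hc
  rwa [Set.union_eq_self_of_subset_right (h.trans hS)]

theorem le (h : SkewCost S Q c) (hc : c ≤ c') : SkewCost S Q c' := by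
  intro T S' hS hT
  obtain ⟨d, rfl⟩ := Nat.exists_eq_add_of_le hc
  rw [← add_assoc]
  induction d with
  | zero => exact h T S' hS hT
  | succ d ih =>
    -- Idle instructions: the constant `0` is computed again and again.
    obtain ⟨val, hval, hmem⟩ := (ih (Nat.le_add_right _ _)).snoc (.inl (.inl ⟨0, rfl⟩))
    exact ⟨val, hval, fun p hp => hmem p (.inr hp)⟩

theorem step {p : MvPolynomial ℕ ℂ} (hp : IsInput p ∨ (∃ q ∈ S, ∃ r ∈ S, p = q + r) ∨
    ∃ q ∈ S, ∃ l, IsInput l ∧ p = l * q) : SkewCost S {p} 1 := by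
  intro T S' hS hc
  rw [Set.union_singleton]
  refine hc.snoc ?_
  rcases hp with h | ⟨q, hq, r, hr, h⟩ | ⟨q, hq, l, hl, h⟩
  · exact .inl h
  · exact .inr (.inl ⟨q, hS hq, r, hS hr, h⟩)
  · exact .inr (.inr ⟨q, hS hq, l, hl, h⟩)

theorem const (a : ℂ) : SkewCost S {MvPolynomial.C a} 1 := step (.inl (.inl ⟨a, rfl⟩))

theorem add {p q : MvPolynomial ℕ ℂ} {c c' : ℕ} (hp : SkewCost S {p} c) (hq : SkewCost S {q} c') :
    SkewCost S {p + q} (c + c' + 1) := by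
  refine ((hp.trans (hq.mono Set.subset_union_left subset_rfl)).trans
    (step (.inr (.inl ⟨p, ?_, q, ?_, rfl⟩)))).mono subset_rfl Set.subset_union_right <;> simp

theorem mul_input {p l : MvPolynomial ℕ ℂ} {c : ℕ} (hp : SkewCost S {p} c) (hl : IsInput l) :
    SkewCost S {l * p} (c + 1) := by
  refine (hp.trans (step (.inr (.inr ⟨p, ?_, l, hl, rfl⟩)))).mono subset_rfl
    Set.subset_union_right
  simp

theorem sum {ι : Type*} (s : Finset ι) {p : ι → MvPolynomial ℕ ℂ}
    (hp : ∀ i ∈ s, SkewCost S {p i} c) :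
    SkewCost S {∑ i ∈ s, p i} (s.card * (c + 1) + 1) := by
  classical
  induction s using Finset.induction_on with
  | empty => simpa using const (S := S) 0
  | insert i s hi ih =>
    rw [Finset.sum_insert hi, Finset.card_insert_of_notMem hi]
    refine ((hp i (Finset.mem_insert_self _ _)).add
      (ih fun j hj => hp j (Finset.mem_insert_of_mem hj))).le (le_of_eq (by ring))

theorem iUnion {ι : Type*} (s : Finset ι) {Q : ι → Set (MvPolynomial ℕ ℂ)}
    (hQ : ∀ i ∈ s, SkewCost S (Q i) c) : SkewCost S (⋃ i ∈ s, Q i) (s.card * c) := by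
  classical
  induction s using Finset.induction_on with
  | empty => simpa using of_subset (S := S) (Set.empty_subset _)
  | insert i s hi ih =>
    rw [Finset.set_biUnion_insert, Finset.card_insert_of_notMem hi]
    exact ((hQ i (Finset.mem_insert_self _ _)).trans
      ((ih fun j hj => hQ j (Finset.mem_insert_of_mem hj)).mono
        Set.subset_union_left subset_rfl)).le (le_of_eq (by ring))

end SkewCost

/-! ### Newton's identities for the characteristic polynomial -/

theorem neg_one_pow_card_mul_prod_map {ι K : Type*} [CommRing K] (s : Multiset ι) (f : ι → K)
    {m : ℕ} (hm : s.card = m) : (-1) ^ m * (s.map f).prod = (s.map fun i => -f i).prod := by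
  subst hm
  induction s using Multiset.induction_on with
  | empty => simp
  | cons i s ih =>
    rw [Multiset.map_cons, Multiset.map_cons, Multiset.prod_cons, Multiset.prod_cons, ← ih,
      Multiset.card_cons]
    ring

open Polynomial in
/-- For a product `p` of linear factors, the determinant of `p(A)` is the product of the values
of `p` at the eigenvalues of `A`. -/
theorem det_aeval_prod_X_sub_C {K : Type*} [Field K] [IsAlgClosed K] {m : ℕ}
    (A : Matrix (Fin m) (Fin m) K) (s : Multiset K) :
    (aeval A (s.map fun μ => X - C μ).prod).det =
      (A.charpoly.roots.map fun l => (s.map fun μ => X - C μ).prod.eval l).prod := by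
  induction s using Multiset.induction_on with
  | empty => simp
  | cons μ s ih =>
    simp only [Multiset.map_cons, Multiset.prod_cons, map_mul, Matrix.det_mul, ih, eval_mul,
      Multiset.prod_map_mul]
    congr 1
    have h1 : (aeval A (X - C μ)) = -(Matrix.scalar (Fin m) μ - A) := by
      simp [Matrix.algebraMap_eq_diagonal, Matrix.scalar, Pi.algebraMap_def]
    have h2 : A.charpoly = (A.charpoly.roots.map fun l => X - C l).prod :=
      (IsAlgClosed.splits A.charpoly).eq_prod_roots_of_monic A.charpoly_monic
    have h3 : A.charpoly.roots.card = m := by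
      rw [← (IsAlgClosed.splits A.charpoly).natDegree_eq_card_roots,
        Matrix.charpoly_natDegree_eq_dim, Fintype.card_fin]
    rw [h1, Matrix.det_neg, ← Matrix.eval_charpoly]
    conv_lhs => rw [h2, eval_multiset_prod, Multiset.map_map]
    simp only [Function.comp_def, eval_sub, eval_X, eval_C, Fintype.card_fin]
    rw [neg_one_pow_card_mul_prod_map _ _ h3]
    simp

open Polynomial in
/-- The trace of a power of a matrix is the power sum of its eigenvalues. -/
theorem trace_pow_eq_sum_roots_pow {K : Type*} [Field K] [IsAlgClosed K] {m : ℕ}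
    (A : Matrix (Fin m) (Fin m) K) (k : ℕ) :
    (A ^ k).trace = (A.charpoly.roots.map fun l => l ^ k).sum := by
  have h3 : A.charpoly.roots.card = m := by
    rw [← (IsAlgClosed.splits A.charpoly).natDegree_eq_card_roots,
      Matrix.charpoly_natDegree_eq_dim, Fintype.card_fin]
  rcases Nat.eq_zero_or_pos k with rfl | hk
  · simp [h3]
  have key : (A ^ k).charpoly =
      ((A.charpoly.roots.map fun l => l ^ k).map fun l => X - C l).prod := by
    apply Polynomial.funext
    intro t
    set g : K[X] := X ^ k - C t with hg
    have hgm : g.Monic := monic_X_pow_sub_C t hk.ne'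
    have hgs : g = (g.roots.map fun μ => X - C μ).prod :=
      (IsAlgClosed.splits g).eq_prod_roots_of_monic hgm
    have hdet := det_aeval_prod_X_sub_C A g.roots
    rw [← hgs] at hdet
    have h1 : aeval A g = -(Matrix.scalar (Fin m) t - A ^ k) := by
      simp [hg, Matrix.algebraMap_eq_diagonal, Matrix.scalar, Pi.algebraMap_def]
    rw [h1, Matrix.det_neg, ← Matrix.eval_charpoly, Fintype.card_fin] at hdet
    rw [Multiset.map_map, eval_multiset_prod, Multiset.map_map]
    have h2 : ((-1) ^ m : K) * (A.charpoly.roots.map fun l => g.eval l).prod =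
        (A.charpoly.roots.map fun l => t - l ^ k).prod := by
      rw [neg_one_pow_card_mul_prod_map _ _ h3]
      simp [hg]
    rw [← hdet, ← mul_assoc, ← mul_pow] at h2
    simpa [Function.comp_def] using h2
  rw [Matrix.trace_eq_sum_roots_charpoly, key, roots_multiset_prod_X_sub_C]

/-- The `k`-th elementary symmetric function of the eigenvalues of a matrix, for `k ≤ m`, read off
from the characteristic polynomial. (For `k > m` the index `m - k` is truncated to `0`, and the
value has no meaning.) -/
noncomputable def eigenvalueEsymm {R : Type*} [CommRing R] {m : ℕ} (A : Matrix (Fin m) (Fin m) R)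
    (k : ℕ) : R :=
  (-1) ^ k * A.charpoly.coeff (m - k)

theorem eigenvalueEsymm_zero {R : Type*} [CommRing R] [Nontrivial R] {m : ℕ}
    (A : Matrix (Fin m) (Fin m) R) : eigenvalueEsymm A 0 = 1 := by
  have := A.charpoly_monic.coeff_natDegree
  rw [Matrix.charpoly_natDegree_eq_dim, Fintype.card_fin] at this
  simp [eigenvalueEsymm, this]

theorem eigenvalueEsymm_card {R : Type*} [CommRing R] {m : ℕ}
    (A : Matrix (Fin m) (Fin m) R) : eigenvalueEsymm A m = A.det := by
  rw [Matrix.det_eq_sign_charpoly_coeff]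
  simp [eigenvalueEsymm]

/-- Newton's identities for the eigenvalues of a matrix. -/
theorem mul_eigenvalueEsymm {R : Type*} [CommRing R] [IsDomain R] {m : ℕ}
    (A : Matrix (Fin m) (Fin m) R) {k : ℕ} (hk : k ≤ m) :
    k * eigenvalueEsymm A k = (-1) ^ (k + 1) *
      ∑ a ∈ Finset.HasAntidiagonal.antidiagonal k with a.1 < k,
        (-1) ^ a.1 * eigenvalueEsymm A a.1 * (A ^ a.2).trace := by
  -- Compare both sides in an algebraically closed field, where the eigenvalues exist.
  let K := AlgebraicClosure (FractionRing R)
  let f : R →+* K := (algebraMap (FractionRing R) K).comp (algebraMap R (FractionRing R))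
  have hf : Function.Injective f :=
    (algebraMap (FractionRing R) K).injective.comp (IsFractionRing.injective R (FractionRing R))
  set B := A.map f with hB
  have hcard : B.charpoly.roots.card = m := by
    rw [← (IsAlgClosed.splits B.charpoly).natDegree_eq_card_roots,
      Matrix.charpoly_natDegree_eq_dim, Fintype.card_fin]
  obtain ⟨l, hl⟩ : ∃ l : Fin m → K, (Finset.univ.val.map l) = B.charpoly.roots := by
    obtain ⟨L, hL⟩ := Quot.exists_rep B.charpoly.roots
    have hL' : (L : Multiset K) = B.charpoly.roots := hL
    have hlen : L.length = m := by rw [← hcard, ← hL', Multiset.coe_card]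
    subst hlen
    exact ⟨L.get, by rw [← hL']; simp [Fin.univ_val_map]⟩
  have htr (i : ℕ) : f (A ^ i).trace = MvPolynomial.aeval l (MvPolynomial.psum (Fin m) ℤ i) := by
    have h1 : f (A ^ i).trace = (B ^ i).trace := by
      rw [hB, ← Matrix.map_pow, ← AddMonoidHom.map_trace]
    rw [h1, trace_pow_eq_sum_roots_pow, ← hl, Multiset.map_map]
    simp only [MvPolynomial.psum, map_sum, map_pow, MvPolynomial.aeval_X]
    rfl
  have hes (i : ℕ) (hi : i ≤ m) :
      f (eigenvalueEsymm A i) = MvPolynomial.aeval l (MvPolynomial.esymm (Fin m) ℤ i) := by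
    have h1 : f (A.charpoly.coeff (m - i)) = B.charpoly.coeff (m - i) := by
      rw [hB, Matrix.charpoly_map, Polynomial.coeff_map]
    have h2 := Polynomial.coeff_eq_esymm_roots_of_card (p := B.charpoly) (k := m - i)
      (by rw [hcard, Matrix.charpoly_natDegree_eq_dim, Fintype.card_fin])
      (by rw [Matrix.charpoly_natDegree_eq_dim, Fintype.card_fin]; omega)
    rw [B.charpoly_monic.leadingCoeff, Matrix.charpoly_natDegree_eq_dim, Fintype.card_fin,
      Nat.sub_sub_self hi, one_mul] at h2
    rw [eigenvalueEsymm, map_mul, h1, h2, MvPolynomial.aeval_esymm_eq_multiset_esymm, hl]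
    rw [map_pow, map_neg, map_one, ← mul_assoc, ← mul_pow, neg_one_mul, neg_neg, one_pow, one_mul]
  apply hf
  have hN := congrArg (MvPolynomial.aeval l) (MvPolynomial.mul_esymm_eq_sum (Fin m) ℤ k)
  simp only [map_mul, map_natCast, map_pow, map_neg, map_one, map_sum] at hN ⊢
  rw [hes k hk, hN]
  congr 1
  refine Finset.sum_congr rfl fun a ha => ?_
  rw [hes a.1 (by have := (Finset.mem_filter.1 ha).2; omega), htr]

/-! ### Skew programs for determinants -/

/-- A linear combination of the polynomials `ξ j`. -/
def IsCombination {σ : Type*} [Fintype σ] (ξ : σ → MvPolynomial ℕ ℂ) (y : MvPolynomial ℕ ℂ) :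
    Prop :=
  ∃ b : σ → ℂ, y = ∑ j, MvPolynomial.C (b j) * ξ j

/-- A bound for the number of instructions that multiply a vector of length `m` by a matrix of
linear combinations of `n` inputs. -/
def vecMulCost (n m : ℕ) : ℕ := m * (m * (n * 3 + 1 + 1) + 1)

/-- A bound for the number of instructions that multiply a polynomial by the trace of a power, with
exponent at most `m`, of an `m × m` matrix of linear combinations of `n` inputs. -/
def traceCost (n m : ℕ) : ℕ := m * (1 + m * vecMulCost n m + 1) + 1

/-- A bound for the number of instructions that compute the determinant of an `m × m` matrix of
linear combinations of `n` inputs. -/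
def detCost (n m : ℕ) : ℕ := (m + 1) * ((m + 1) * (traceCost n m + 1 + 1) + 1 + 1)

namespace SkewCost

variable {S : Set (MvPolynomial ℕ ℂ)} {σ : Type*} [Fintype σ] {ξ : σ → MvPolynomial ℕ ℂ} {m : ℕ}

theorem combination_mul (hξ : ∀ j, IsInput (ξ j)) {y p : MvPolynomial ℕ ℂ}
    (hy : IsCombination ξ y) (hp : p ∈ S) : SkewCost S {y * p} (Fintype.card σ * 3 + 1) := by
  obtain ⟨b, rfl⟩ := hy
  rw [Finset.sum_mul]
  refine sum (c := 2) Finset.univ fun j _ => ?_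
  rw [mul_assoc]
  exact ((of_subset (Set.singleton_subset_iff.2 hp)).mul_input (hξ j)).mul_input (.inl ⟨b j, rfl⟩)

theorem vecMul (hξ : ∀ j, IsInput (ξ j)) {Y : Matrix (Fin m) (Fin m) (MvPolynomial ℕ ℂ)}
    (hY : ∀ i j, IsCombination ξ (Y i j)) {v : Fin m → MvPolynomial ℕ ℂ}
    (hv : Set.range v ⊆ S) :
    SkewCost S (Set.range (v ᵥ* Y)) (vecMulCost (Fintype.card σ) m) := by
  have h (j : Fin m) : SkewCost S {(v ᵥ* Y) j} (m * (Fintype.card σ * 3 + 1 + 1) + 1) := by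
    have := sum (S := S) (p := fun i => Y i j * v i) Finset.univ fun i _ =>
      combination_mul hξ (hY i j) (hv ⟨i, rfl⟩)
    rw [Finset.card_univ, Fintype.card_fin] at this
    convert! this using 2
    simp [Matrix.vecMul, dotProduct, mul_comm]
  have := iUnion Finset.univ fun j _ => h j
  rw [Finset.card_univ, Fintype.card_fin] at this
  refine this.mono subset_rfl ?_
  rintro _ ⟨j, rfl⟩
  exact Set.mem_iUnion₂.2 ⟨j, Finset.mem_univ j, rfl⟩

theorem vecMul_pow (hξ : ∀ j, IsInput (ξ j)) {Y : Matrix (Fin m) (Fin m) (MvPolynomial ℕ ℂ)}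
    (hY : ∀ i j, IsCombination ξ (Y i j)) {v : Fin m → MvPolynomial ℕ ℂ}
    (hv : Set.range v ⊆ S) (k : ℕ) :
    SkewCost S (Set.range (v ᵥ* (Y ^ k))) (k * vecMulCost (Fintype.card σ) m) := by
  induction k with
  | zero => simpa using of_subset hv
  | succ k ih =>
    rw [pow_succ, ← Matrix.vecMul_vecMul]
    exact ((ih.trans (vecMul hξ hY Set.subset_union_right)).mono subset_rfl
      Set.subset_union_right).le (le_of_eq (by ring))

/-- The product `q * tr (Y ^ k)` is the sum of the `a`-th coordinates of `(q • e_a) * Y ^ k`. -/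
theorem mul_trace_pow (hξ : ∀ j, IsInput (ξ j)) {Y : Matrix (Fin m) (Fin m) (MvPolynomial ℕ ℂ)}
    (hY : ∀ i j, IsCombination ξ (Y i j)) {q : MvPolynomial ℕ ℂ} (hq : q ∈ S) {k : ℕ}
    (hk : k ≤ m) : SkewCost S {q * (Y ^ k).trace} (traceCost (Fintype.card σ) m) := by
  have h (a : Fin m) : SkewCost S {(Pi.single a q ᵥ* (Y ^ k)) a}
      (1 + m * vecMulCost (Fintype.card σ) m) := by
    have hr : Set.range (Pi.single a q : Fin m → MvPolynomial ℕ ℂ) ⊆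
        S ∪ {MvPolynomial.C 0} := by
      rintro _ ⟨b, rfl⟩
      rw [Pi.single_apply]
      split_ifs
      · exact .inl hq
      · simp
    refine (((const 0).trans (vecMul_pow hξ hY hr k)).mono subset_rfl ?_).le
      (Nat.add_le_add_left (Nat.mul_le_mul_right _ hk) _)
    rintro _ rfl
    exact .inr ⟨a, rfl⟩
  have := sum Finset.univ fun a _ => h a
  rw [Finset.card_univ, Fintype.card_fin] at this
  have heq : q * (Y ^ k).trace = ∑ a, (Pi.single a q ᵥ* (Y ^ k)) a := by
    simp [Matrix.trace, Finset.mul_sum]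
  rw [heq]
  exact this

/-- Newton's identities compute the elementary symmetric functions of the eigenvalues successively,
and the last one of them is the determinant. -/
theorem det (hξ : ∀ j, IsInput (ξ j)) {Y : Matrix (Fin m) (Fin m) (MvPolynomial ℕ ℂ)}
    (hY : ∀ i j, IsCombination ξ (Y i j)) :
    SkewCost S {Y.det} (detCost (Fintype.card σ) m) := by
  set η := (m + 1) * (traceCost (Fintype.card σ) m + 1 + 1) + 1 + 1 with hη
  have h (k : ℕ) (hk : k ≤ m) :
      SkewCost S {p | ∃ i ≤ k, p = eigenvalueEsymm Y i} ((k + 1) * η) := by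
    induction k with
    | zero =>
      refine ((const 1).mono subset_rfl ?_).le (by omega)
      rintro _ ⟨i, hi, rfl⟩
      rw [Nat.le_zero.1 hi, eigenvalueEsymm_zero]
      simp
    | succ k ih =>
      refine ((ih (by omega)).trans (Q' := {eigenvalueEsymm Y (k + 1)}) (c' := η) ?_).mono
        subset_rfl ?_ |>.le (le_of_eq (by ring))
      · have hk0 : ((k + 1 : ℕ) : ℂ) ≠ 0 := by exact_mod_cast Nat.succ_ne_zero k
        have heq : eigenvalueEsymm Y (k + 1) =
            MvPolynomial.C (((k + 1 : ℕ) : ℂ)⁻¹ * (-1) ^ (k + 1 + 1)) *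
              ∑ a ∈ Finset.HasAntidiagonal.antidiagonal (k + 1) with a.1 < k + 1,
                MvPolynomial.C ((-1) ^ a.1) * (eigenvalueEsymm Y a.1 * (Y ^ a.2).trace) := by
          have hN := mul_eigenvalueEsymm Y hk
          have hc : MvPolynomial.C (((k + 1 : ℕ) : ℂ)⁻¹) * ((k + 1 : ℕ) : MvPolynomial ℕ ℂ) =
              1 := by
            rw [← map_natCast (MvPolynomial.C (σ := ℕ) (R := ℂ)), ← map_mul,
              inv_mul_cancel₀ hk0, map_one]
          rw [← one_mul (eigenvalueEsymm Y (k + 1)), ← hc, mul_assoc, hN]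
          simp only [map_mul, map_pow, map_neg, map_one, mul_assoc]
        rw [heq]
        refine (mul_input ((sum (c := traceCost (Fintype.card σ) m + 1) _
          fun a ha => ?_).le ?_) (.inl ⟨_, rfl⟩))
        · rw [Finset.mem_filter, Finset.HasAntidiagonal.mem_antidiagonal] at ha
          refine mul_input (mul_trace_pow hξ hY (.inr ⟨a.1, by omega, rfl⟩) (by omega))
            (.inl ⟨_, rfl⟩)
        · refine Nat.add_le_add_right (Nat.mul_le_mul_right _ ?_) _
          -- The condition `a.1 < k + 1` removes one pair, which leaves `k + 1 ≤ m` summands.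
          refine (Finset.card_le_card
            (t := Finset.HasAntidiagonal.antidiagonal (k + 1) \ {(k + 1, 0)}) ?_).trans ?_
          · intro a ha
            rw [Finset.mem_filter] at ha
            simp only [Finset.mem_sdiff, ha.1, Finset.mem_singleton, true_and]
            rintro rfl
            exact lt_irrefl _ ha.2
          · rw [Finset.card_sdiff_of_subset (by simp), Finset.Nat.card_antidiagonal]
            simp
            omega
      · rintro _ ⟨i, hi, rfl⟩
        rcases Nat.le_succ_iff.1 hi with hi | rfl
        · exact .inl ⟨i, hi, rfl⟩
        · exact .inr rfl
  refine (h m le_rfl).mono subset_rfl ?_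
  rintro _ rfl
  exact ⟨m, le_rfl, (eigenvalueEsymm_card Y).symm⟩

end SkewCost

/-! ### Linear substitutions into the determinant -/

section LinSubst

open MvPolynomial

theorem linSubst_detPoly {R : Type*} [CommRing R] [Algebra ℂ R] {m : ℕ}
    (B : Matrix (Fin m × Fin m) (Fin m × Fin m) R) :
    linSubst B (detPoly m) = (Matrix.of fun i k => ∑ j, C (B (i, k) j) * X j).det := by
  rw [linSubst, detPoly, AlgHom.map_det]
  congr 1
  ext i k : 2
  simp [Matrix.mvPolynomialX]

theorem linSubst_detPoly_isHomogeneous {m : ℕ}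
    (B : Matrix (Fin m × Fin m) (Fin m × Fin m) ℂ) :
    (linSubst B (detPoly m)).IsHomogeneous m := by
  rw [linSubst_detPoly, Matrix.det_apply']
  apply IsHomogeneous.sum
  intro τ _
  have h := IsHomogeneous.prod Finset.univ
    (fun i => ∑ j, C (B (τ i, i) j) * (X j : MvPolynomial (Fin m × Fin m) ℂ)) (fun _ => 1)
    fun i _ => IsHomogeneous.sum _ _ _ fun j _ => isHomogeneous_C_mul_X _ _
  have h' := (isHomogeneous_C (Fin m × Fin m) ((Equiv.Perm.sign τ : ℤ) : ℂ)).mul h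
  simpa using h'

theorem map_linSubst {σ R S : Type*} [Fintype σ] [CommRing R] [Algebra ℂ R] [CommRing S]
    [Algebra ℂ S] (φ : R →ₐ[ℂ] S) (B : Matrix σ σ R) (g : MvPolynomial σ ℂ) :
    map (φ : R →+* S) (linSubst B g) = linSubst (B.map φ) g := by
  induction g using MvPolynomial.induction_on with
  | C a => simp [linSubst, MvPolynomial.algebraMap_apply]
  | add p q hp hq =>
    simp only [linSubst, map_add] at hp hq ⊢
    rw [hp, hq]
  | mul_X p i hp =>
    simp only [linSubst, map_mul] at hp ⊢
    rw [hp]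
    simp

/-- The invertible matrices are Zariski dense, hence polynomials in the coefficients that vanish on
the orbit of a form vanish at all its linear substitutions, also at the singular ones. -/
theorem eval_coeff_linSubst_eq_zero {σ : Type*} [Fintype σ] [DecidableEq σ]
    (g : MvPolynomial σ ℂ) (P : MvPolynomial (σ →₀ ℕ) ℂ)
    (hP : ∀ A : GL σ ℂ, eval (fun s => coeff s (linSubst (A : Matrix σ σ ℂ) g)) P = 0)
    (B : Matrix σ σ ℂ) : eval (fun s => coeff s (linSubst B g)) P = 0 := by
  set Q : MvPolynomial (σ × σ) ℂ :=
    bind₁ (fun s => coeff s (linSubst (Matrix.mvPolynomialX σ σ ℂ) g)) P with hQ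
  have heval (B : Matrix σ σ ℂ) :
      eval (fun ij : σ × σ => B ij.1 ij.2) Q = eval (fun s => coeff s (linSubst B g)) P := by
    have hB : (Matrix.mvPolynomialX σ σ ℂ).map (aeval fun ij : σ × σ => B ij.1 ij.2) = B := by
      ext i j
      simp [Matrix.mvPolynomialX]
    have hc (s : σ →₀ ℕ) : eval (fun ij : σ × σ => B ij.1 ij.2)
        (coeff s (linSubst (Matrix.mvPolynomialX σ σ ℂ) g)) = coeff s (linSubst B g) := by
      conv_rhs => rw [← hB, ← map_linSubst, coeff_map]
      simp
    rw [hQ, ← coe_aeval_eq_eval, ← coe_aeval_eq_eval]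
    simp only [RingHom.coe_coe, aeval_bind₁]
    congr 2
    funext s
    rw [← hc s, ← coe_aeval_eq_eval]
    rfl
  have h0 : Q = 0 := eq_of_eval_eq_on_gl fun A => by rw [heval, hP A, map_zero]
  rw [← heval, h0, map_zero]

end LinSubst

/-! ### Dehomogenization -/

section Dehomogenize

open MvPolynomial

variable {σ : Type*} (e : σ → Option ℕ)

/-- The value substituted for a variable: a variable labelled `none` is set to `1`, and a variable
labelled `some i` becomes `X i`. -/
noncomputable def dehomVar (j : σ) : MvPolynomial ℕ ℂ := (e j).elim 1 X

theorem isInput_dehomVar (j : σ) : IsInput (dehomVar e j) := by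
  rw [dehomVar]
  cases e j with
  | none => exact .inl ⟨1, by simp⟩
  | some i => exact .inr ⟨i, rfl⟩

/-- Dehomogenization of polynomials whose variables are labelled by the map `e`. -/
noncomputable def dehom : MvPolynomial σ ℂ →ₐ[ℂ] MvPolynomial ℕ ℂ := aeval (dehomVar e)

/-- The exponent vector of a dehomogenized monomial. -/
noncomputable def dehomExponent (u : σ →₀ ℕ) : ℕ →₀ ℕ := (u.mapDomain e).some

theorem dehom_monomial (u : σ →₀ ℕ) (c : ℂ) :
    dehom e (monomial u c) = monomial (dehomExponent e u) c := by
  induction u using Finsupp.induction_linear generalizing c with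
  | zero => simp [dehom, dehomExponent, algebraMap_eq]
  | add u v hu hv =>
    have h1 : monomial (u + v) c = monomial u c * monomial v (1 : ℂ) := by
      rw [monomial_mul, mul_one]
    rw [h1, map_mul, hu, hv, monomial_mul, mul_one]
    simp [dehomExponent, Finsupp.mapDomain_add, Finsupp.some_add]
  | single j k =>
    simp only [dehom, aeval_monomial, dehomExponent, Finsupp.mapDomain_single, dehomVar,
      algebraMap_eq]
    cases h : e j with
    | none => simp [h]
    | some i => simp [h, C_mul_X_pow_eq_monomial]

theorem dehom_eq_sum (G : MvPolynomial σ ℂ) :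
    dehom e G = ∑ u ∈ G.support, monomial (dehomExponent e u) (coeff u G) := by
  conv_lhs => rw [G.as_sum]
  simp only [map_sum, dehom_monomial]

theorem degree_dehomExponent_add (u : σ →₀ ℕ) :
    (u.mapDomain e) none + (dehomExponent e u).degree = u.degree := by
  rw [← Finsupp.degree_mapDomain e u, dehomExponent]
  generalize u.mapDomain e = w
  have := Finsupp.sum_option_index w (fun _ n => n) (fun _ => rfl) (fun _ _ _ => rfl)
  simpa [Finsupp.degree_apply, Finsupp.sum] using this.symm

variable {e}

theorem dehomExponent_injOn (he : Function.Injective e) {u v : σ →₀ ℕ}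
    (huv : u.degree = v.degree) (h : dehomExponent e u = dehomExponent e v) : u = v := by
  apply Finsupp.mapDomain_injective he
  have hu := degree_dehomExponent_add e u
  have hv := degree_dehomExponent_add e v
  ext o
  cases o with
  | none =>
    rw [h] at hu
    omega
  | some i => exact DFunLike.congr_fun h i

/-- On forms of a fixed degree, dehomogenization preserves the coefficients. -/
theorem coeff_dehom (he : Function.Injective e) {G : MvPolynomial σ ℂ} {m : ℕ}
    (hG : G.IsHomogeneous m) {u : σ →₀ ℕ} (hu : u.degree = m) :
    coeff (dehomExponent e u) (dehom e G) = coeff u G := by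
  classical
  rw [dehom_eq_sum, coeff_sum]
  simp only [coeff_monomial]
  rw [Finset.sum_eq_single u]
  · simp
  · intro v hv hvu
    rw [if_neg]
    intro h
    refine hvu (dehomExponent_injOn he ?_ h)
    rw [hu]
    by_contra hne
    exact (mem_support_iff.1 hv) (hG.coeff_eq_zero hne)
  · intro h
    simp [notMem_support_iff.1 h]

theorem totalDegree_dehom_le {G : MvPolynomial σ ℂ} {m : ℕ} (hG : G.IsHomogeneous m) :
    (dehom e G).totalDegree ≤ m := by
  rw [dehom_eq_sum]
  refine totalDegree_finsetSum_le fun u hu => (totalDegree_monomial_le _ _).trans ?_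
  have h1 := degree_dehomExponent_add e u
  have h2 : u.degree = m := by
    by_contra hne
    exact (mem_support_iff.1 hu) (hG.coeff_eq_zero hne)
  have h3 : ((dehomExponent e u).sum fun _ => id) = (dehomExponent e u).degree := by
    simp [Finsupp.degree_apply, Finsupp.sum]
  change ((dehomExponent e u).sum fun _ => id) ≤ m
  omega

theorem exists_isHomogeneous_dehom_eq (hnone : ∃ j, e j = none) {f : MvPolynomial ℕ ℂ} {m : ℕ}
    (hvars : ∀ i ∈ f.vars, ∃ j, e j = some i) (hdeg : f.totalDegree ≤ m) :
    ∃ F : MvPolynomial σ ℂ, F.IsHomogeneous m ∧ dehom e F = f := by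
  obtain ⟨j₀, hj₀⟩ := hnone
  have hmon (s : ℕ →₀ ℕ) (hs : s ∈ f.support) : ∃ F : MvPolynomial σ ℂ, F.IsHomogeneous m ∧
      dehom e F = monomial s (coeff s f) := by
    have hj (i : ℕ) (hi : i ∈ s.support) : ∃ j, e j = some i :=
      hvars i ((mem_vars_iff_mem_support i).2 ⟨s, hs, hi⟩)
    have : Nonempty σ := ⟨j₀⟩
    choose! j hj using hj
    have hsm : s.degree ≤ m := by
      refine le_trans ?_ ((le_totalDegree hs).trans hdeg)
      simp [Finsupp.degree_apply, Finsupp.sum]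
    refine ⟨monomial (s.mapDomain j + Finsupp.single j₀ (m - s.degree)) (coeff s f),
      isHomogeneous_monomial _ ?_, ?_⟩
    · simp only [map_add, Finsupp.degree_mapDomain, Finsupp.degree_single]
      omega
    · rw [dehom_monomial, dehomExponent, Finsupp.mapDomain_add, Finsupp.some_add,
        Finsupp.mapDomain_single, hj₀, Finsupp.some_single_none, add_zero,
        ← Finsupp.mapDomain_comp]
      have : s.mapDomain (e ∘ j) = s.mapDomain some :=
        Finsupp.mapDomain_congr fun i hi => hj i hi
      have hsome : (s.mapDomain some).some = s := by
        ext i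
        rw [Finsupp.some_apply, Finsupp.mapDomain_apply (Option.some_injective ℕ)]
      rw [this, hsome]
  choose! F hF₁ hF₂ using hmon
  refine ⟨∑ s ∈ f.support, F s, IsHomogeneous.sum _ _ _ hF₁, ?_⟩
  rw [map_sum, Finset.sum_congr rfl hF₂, ← f.as_sum]

open Classical in
/-- Setting the variables outside of the range of the labelling to zero. -/
noncomputable def dropVars (e : σ → Option ℕ) : MvPolynomial ℕ ℂ →ₐ[ℂ] MvPolynomial ℕ ℂ :=
  aeval fun i => if ∃ j, e j = some i then X i else 0

theorem dropVars_monomial (s : ℕ →₀ ℕ) (c : ℂ) :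
    dropVars e (monomial s c) = monomial s c ∨
      ((∃ i ∈ s.support, ¬ ∃ j, e j = some i) ∧ dropVars e (monomial s c) = 0) := by
  classical
  rw [dropVars, aeval_monomial, algebraMap_eq]
  by_cases h : ∃ i ∈ s.support, ¬ ∃ j, e j = some i
  · refine .inr ⟨h, ?_⟩
    obtain ⟨i, hi, hij⟩ := h
    rw [Finsupp.prod, Finset.prod_eq_zero hi, mul_zero]
    rw [if_neg hij, zero_pow (Finsupp.mem_support_iff.1 hi)]
  · left
    push Not at h
    rw [monomial_eq]
    congr 1
    exact Finset.prod_congr rfl fun i hi => by simp [h i hi]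

theorem coeff_dropVars {s : ℕ →₀ ℕ} (hs : ∀ i ∈ s.support, ∃ j, e j = some i)
    (g : MvPolynomial ℕ ℂ) : coeff s (dropVars e g) = coeff s g := by
  classical
  induction g using MvPolynomial.induction_on' with
  | monomial t c =>
    rcases dropVars_monomial (e := e) t c with h | ⟨⟨i, hi, hij⟩, h⟩
    · rw [h]
    · rw [h, coeff_zero, coeff_monomial, if_neg]
      rintro rfl
      exact hij (hs i hi)
  | add p q hp hq => rw [map_add, coeff_add, coeff_add, hp, hq]

theorem mem_support_dehomExponent {u : σ →₀ ℕ} {i : ℕ} (hi : i ∈ (dehomExponent e u).support) :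
    ∃ j, e j = some i := by
  classical
  rw [Finsupp.mem_support_iff, dehomExponent, Finsupp.some_apply] at hi
  have := Finsupp.mapDomain_support (Finsupp.mem_support_iff.2 hi)
  obtain ⟨j, -, hj⟩ := Finset.mem_image.1 this
  exact ⟨j, hj⟩

variable [Fintype σ]

theorem exists_dropVars_eq_of_mem_affineForms (hnone : ∃ j, e j = none) {a : MvPolynomial ℕ ℂ}
    (ha : a ∈ affineForms) : ∃ b : σ → ℂ, dropVars e a = ∑ j, C (b j) * dehomVar e j := by
  classical
  obtain ⟨j₀, hj₀⟩ := hnone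
  have hsingle (j : σ) :
      dehomVar e j = ∑ k, C (Pi.single (M := fun _ => ℂ) j 1 k) * dehomVar e k := by
    simp [Pi.single_apply]
  induction ha using Submodule.span_induction with
  | mem x hx =>
    rcases hx with rfl | ⟨i, rfl⟩
    · exact ⟨Pi.single j₀ 1, by rw [← hsingle, map_one, dehomVar, hj₀, Option.elim_none]⟩
    · by_cases h : ∃ j, e j = some i
      · obtain ⟨j, hj⟩ := h
        refine ⟨Pi.single j 1, ?_⟩
        rw [← hsingle, dropVars, aeval_X, if_pos ⟨j, hj⟩, dehomVar, hj, Option.elim_some]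
      · exact ⟨0, by simp [dropVars, h]⟩
  | zero => exact ⟨0, by simp⟩
  | add x y _ _ hx hy =>
    obtain ⟨b, hb⟩ := hx
    obtain ⟨c, hc⟩ := hy
    exact ⟨b + c, by simp [hb, hc, add_mul, Finset.sum_add_distrib]⟩
  | smul r x _ hx =>
    obtain ⟨b, hb⟩ := hx
    exact ⟨r • b, by simp [hb, smul_eq_C_mul, Finset.mul_sum, mul_assoc]⟩

end Dehomogenize

/-! ### Limits of determinants of affine matrices -/

section Topology

open MvPolynomial

theorem continuous_coeff_limitTopology (s : ℕ →₀ ℕ) :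
    @Continuous _ _ limitTopology _ fun f : MvPolynomial ℕ ℂ => coeff s f := by
  refine continuous_iSup_dom.2 fun n => continuous_iSup_dom.2 fun d =>
    continuous_coinduced_dom.2 ?_
  let _ := euclideanTopology n d
  exact (continuous_apply s).comp continuous_induced_dom

theorem eq_zero_of_mem_closure {S : Set (MvPolynomial ℕ ℂ)} {φ : MvPolynomial ℕ ℂ → ℂ}
    (hφ : @Continuous _ _ limitTopology _ φ) (hS : ∀ g ∈ S, φ g = 0) {f : MvPolynomial ℕ ℂ}
    (hf : f ∈ @closure _ limitTopology S) : φ f = 0 := by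
  let _ := limitTopology
  exact closure_minimal (t := φ ⁻¹' {0}) hS (isClosed_singleton.preimage hφ) hf

/-- The number of variables is lower semicontinuous. -/
theorem card_vars_le_of_mem_closure {S : Set (MvPolynomial ℕ ℂ)} {r : ℕ}
    (hS : ∀ g ∈ S, g.vars.card ≤ r) {f : MvPolynomial ℕ ℂ}
    (hf : f ∈ @closure _ limitTopology S) : f.vars.card ≤ r := by
  let _ := limitTopology
  have hs (i : ℕ) (hi : i ∈ f.vars) : ∃ s ∈ f.support, i ∈ s.support :=
    (mem_vars_iff_mem_support i).1 hi
  choose! s hs₁ hs₂ using hs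
  have hopen : IsOpen (⋂ i ∈ f.vars, {g : MvPolynomial ℕ ℂ | coeff (s i) g ≠ 0}) :=
    isOpen_biInter_finset fun i _ =>
      isOpen_ne.preimage (continuous_coeff_limitTopology (s i))
  obtain ⟨g, hg, hgS⟩ := mem_closure_iff.1 hf _ hopen
    (Set.mem_iInter₂.2 fun i hi => mem_support_iff.1 (hs₁ i hi))
  refine (Finset.card_le_card fun i hi => ?_).trans (hS g hgS)
  exact (mem_vars_iff_mem_support i).2
    ⟨s i, mem_support_iff.2 (Set.mem_iInter₂.1 hg i hi), hs₂ i hi⟩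

/-- Every limit of polynomials of weakly-skew complexity at most `r` is a dehomogenization of a
form in the orbit closure of the determinant of size `r + 1`. -/
theorem exists_mem_detOrbitClosure {f : MvPolynomial ℕ ℂ} {r : ℕ}
    (hf : f ∈ @closure _ limitTopology {g | Lws g ≤ r}) :
    ∃ (e : Fin (r + 1) × Fin (r + 1) → Option ℕ), ∃ F ∈ detOrbitClosure (r + 1),
      dehom e F = f := by
  classical
  set m := r + 1 with hm
  have hvars := card_vars_le_of_mem_closure (fun g hg => (exists_det_of_Lws_le hg).1) hf
  -- Label the variables injectively by `none`, the variables of `f`, and further variables.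
  obtain ⟨T, hT, hTcard⟩ := Infinite.exists_superset_card_eq
    (insert none (f.vars.map Function.Embedding.some)) (m * m)
    ((Finset.card_insert_le _ _).trans (by rw [Finset.card_map]; nlinarith))
  let E : Fin m × Fin m ≃ T := Fintype.equivOfCardEq (by simp [hTcard])
  let e : Fin m × Fin m → Option ℕ := fun j => (E j).1
  have he : Function.Injective e := Subtype.val_injective.comp E.injective
  have hsurj (o : Option ℕ) (ho : o ∈ insert none (f.vars.map Function.Embedding.some)) :
      ∃ j, e j = o := ⟨E.symm ⟨o, hT ho⟩, by simp [e]⟩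
  have hnone := hsurj none (Finset.mem_insert_self _ _)
  have hsome (i : ℕ) (hi : i ∈ f.vars) : ∃ j, e j = some i :=
    hsurj _ (Finset.mem_insert_of_mem (Finset.mem_map_of_mem _ hi))
  have hdet (g : MvPolynomial ℕ ℂ) (hg : Lws g ≤ r) :
      ∃ B : Matrix (Fin m × Fin m) (Fin m × Fin m) ℂ,
        dropVars e g = dehom e (linSubst B (detPoly m)) := by
    obtain ⟨-, M, hM, rfl⟩ := exists_det_of_Lws_le hg
    choose b hb using fun i k => exists_dropVars_eq_of_mem_affineForms hnone (hM i k)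
    refine ⟨Matrix.of fun ik j => b ik.1 ik.2 j, ?_⟩
    rw [linSubst_detPoly, AlgHom.map_det, AlgHom.map_det]
    congr 1
    ext i k : 2
    simp [hb, dehom, algebraMap_eq]
  have hdeg : f.totalDegree ≤ m := by
    refine Finset.sup_le fun s hs => ?_
    by_contra hlt
    refine mem_support_iff.1 hs (eq_zero_of_mem_closure (continuous_coeff_limitTopology s)
      (fun g hg => ?_) hf)
    obtain ⟨B, hB⟩ := hdet g hg
    rw [← coeff_dropVars (e := e) fun i hi => hsome i ((mem_vars_iff_mem_support i).2 ⟨s, hs, hi⟩),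
      hB]
    by_contra hne
    have := (le_totalDegree (mem_support_iff.2 hne)).trans
      (totalDegree_dehom_le (linSubst_detPoly_isHomogeneous B))
    exact hlt this
  obtain ⟨F, hF, hFf⟩ := exists_isHomogeneous_dehom_eq hnone hsome hdeg
  refine ⟨e, F, ⟨hF, fun P hP => ?_⟩, hFf⟩
  -- The coefficients of a form of degree `m`, read off from its dehomogenization `h`.
  set c : MvPolynomial ℕ ℂ → (Fin m × Fin m →₀ ℕ) → ℂ := fun h u =>
    if u.degree = m then coeff (dehomExponent e u) h else 0 with hc
  have hcoeff (G : MvPolynomial (Fin m × Fin m) ℂ) (hG : G.IsHomogeneous m)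
      (h : MvPolynomial ℕ ℂ) (hh : dropVars e h = dehom e G) : c h = fun u => coeff u G := by
    funext u
    by_cases hu : u.degree = m
    · rw [hc]
      simp only [if_pos hu]
      rw [← coeff_dropVars fun i hi => mem_support_dehomExponent hi, hh, coeff_dehom he hG hu]
    · simp [hc, hu, hG.coeff_eq_zero hu]
  have hdrop : dropVars e f = f := by
    rw [f.as_sum, map_sum]
    refine Finset.sum_congr rfl fun s hs => ?_
    rcases dropVars_monomial (e := e) s (coeff s f) with h | ⟨⟨i, hi, hij⟩, -⟩
    · exact h
    · exact (hij (hsome i ((mem_vars_iff_mem_support i).2 ⟨s, hs, hi⟩))).elim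
  rw [← hcoeff F hF f (hdrop.trans hFf.symm)]
  refine eq_zero_of_mem_closure (φ := fun h => eval (c h) P) ?_ (fun g hg => ?_) hf
  · let _ := limitTopology
    refine (continuous_eval P).comp (continuous_pi fun u => ?_)
    by_cases hu : u.degree = m
    · simpa [hc, hu] using continuous_coeff_limitTopology (dehomExponent e u)
    · simp only [hc, hu, if_false]
      exact continuous_const
  · obtain ⟨B, hB⟩ := hdet g hg
    simp only [hcoeff _ (linSubst_detPoly_isHomogeneous B) g hB]
    exact eval_coeff_linSubst_eq_zero _ P (fun A => hP _ ⟨A, rfl⟩) B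

end Topology

/-! ### From curves of bounded order to linear combinations of determinants -/

section Interpolation

open Polynomial in
/-- A coefficient of a polynomial of degree at most `n` is a linear combination, independent of the
polynomial, of its values at the points `0, …, n`. -/
theorem exists_coeff_eq_sum_eval (A : Type*) [CommRing A] [Algebra ℂ A] (n q : ℕ) :
    ∃ w : ℕ → ℂ, ∀ p : A[X], p.natDegree ≤ n →
      p.coeff q = ∑ i ∈ Finset.range (n + 1), algebraMap ℂ A (w i) *
        p.eval (algebraMap ℂ A (i : ℂ)) := by
  have hinj : Set.InjOn (fun i : ℕ => (i : ℂ)) (Finset.range (n + 1)) :=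
    Nat.cast_injective.injOn
  refine ⟨fun i => (Lagrange.basis (Finset.range (n + 1)) (fun i : ℕ => (i : ℂ)) i).coeff q,
    fun p hp => ?_⟩
  have hpow (k : ℕ) (hk : k < n + 1) : (∑ i ∈ Finset.range (n + 1),
      (Lagrange.basis (Finset.range (n + 1)) (fun i : ℕ => (i : ℂ)) i).coeff q * (i : ℂ) ^ k) =
        if q = k then 1 else 0 := by
    have h := Lagrange.eq_interpolate (f := (X ^ k : ℂ[X])) hinj (by
      rw [degree_X_pow, Finset.card_range]
      exact_mod_cast hk)
    have h' := congrArg (fun g => g.coeff q) h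
    simp only [Lagrange.interpolate_apply, finsetSum_coeff, coeff_C_mul, eval_pow, eval_X,
      coeff_X_pow] at h'
    rw [h']
    exact Finset.sum_congr rfl fun i _ => mul_comm _ _
  have hev (i : ℕ) : p.eval (algebraMap ℂ A (i : ℂ)) =
      ∑ k ∈ Finset.range (n + 1), p.coeff k * algebraMap ℂ A ((i : ℂ) ^ k) := by
    rw [eval_eq_sum_range' (Nat.lt_succ_of_le hp)]
    simp only [map_pow]
  simp only [hev, Finset.mul_sum]
  rw [Finset.sum_comm]
  have hcol (k : ℕ) (hk : k ∈ Finset.range (n + 1)) : ∑ i ∈ Finset.range (n + 1),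
      algebraMap ℂ A ((Lagrange.basis (Finset.range (n + 1)) (fun i : ℕ => (i : ℂ)) i).coeff q) *
        (p.coeff k * algebraMap ℂ A ((i : ℂ) ^ k)) = if q = k then p.coeff k else 0 := by
    have h := congrArg (fun c => p.coeff k * algebraMap ℂ A c) (hpow k (Finset.mem_range.1 hk))
    simp only [map_sum, map_mul, Finset.mul_sum] at h
    rw [apply_ite (algebraMap ℂ A), map_one, map_zero, mul_ite, mul_one, mul_zero] at h
    rw [← h]
    exact Finset.sum_congr rfl fun i _ => by ring
  rw [Finset.sum_congr rfl hcol, Finset.sum_ite_eq]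
  split_ifs with hq
  · rfl
  · exact coeff_eq_zero_of_natDegree_lt (by rw [Finset.mem_range] at hq; omega)

open Polynomial in
theorem natDegree_det_le {A : Type*} [CommRing A] {m d : ℕ} (Y : Matrix (Fin m) (Fin m) A[X])
    (hY : ∀ i j, (Y i j).natDegree ≤ d) : Y.det.natDegree ≤ m * d := by
  rw [Matrix.det_apply]
  refine natDegree_sum_le_of_forall_le _ _ fun τ _ => ?_
  refine (natDegree_smul_le _ _).trans ((natDegree_prod_le _ _).trans ?_)
  refine (Finset.sum_le_sum fun i _ => hY (τ i) i).trans ?_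
  simp

/-- Low coefficients of a determinant depend only on the low coefficients of the entries. -/
theorem coeff_det_eq_of_coeff_eq {A : Type*} [CommRing A] {m q : ℕ}
    (Y Z : Matrix (Fin m) (Fin m) A⟦X⟧)
    (h : ∀ i j, ∀ d ≤ q, PowerSeries.coeff d (Y i j) = PowerSeries.coeff d (Z i j)) :
    PowerSeries.coeff q Y.det = PowerSeries.coeff q Z.det := by
  let I : Ideal A⟦X⟧ := Ideal.span {PowerSeries.X ^ (q + 1)}
  have hmem (a b : A⟦X⟧) : Ideal.Quotient.mk I a = Ideal.Quotient.mk I b ↔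
      ∀ d ≤ q, PowerSeries.coeff d a = PowerSeries.coeff d b := by
    rw [Ideal.Quotient.eq, Ideal.mem_span_singleton, PowerSeries.X_pow_dvd_iff]
    simp only [map_sub, sub_eq_zero, Nat.lt_succ_iff]
  refine (hmem _ _).1 ?_ q le_rfl
  rw [RingHom.map_det, RingHom.map_det]
  congr 1
  ext i j : 2
  exact (hmem _ _).2 (h i j)

open MvPolynomial in
/-- A form that is approximated with order `q` is a linear combination of `m * q + 1` determinants
of matrices of linear forms: truncated at order `q`, the curve becomes polynomial, and the
coefficient of order `q` is found by interpolation. -/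
theorem ApproximableWithOrder.exists_eq_sum_linSubst {m q : ℕ}
    {F : MvPolynomial (Fin m × Fin m) ℂ} (h : ApproximableWithOrder m F q) :
    ∃ (w : ℕ → ℂ) (B : ℕ → Matrix (Fin m × Fin m) (Fin m × Fin m) ℂ),
      F = ∑ i ∈ Finset.range (m * q + 1), C (w i) * linSubst (B i) (detPoly m) := by
  obtain ⟨B, G, -, -, hB⟩ := h
  obtain ⟨w, hw⟩ := exists_coeff_eq_sum_eval (MvPolynomial (Fin m × Fin m) ℂ) (m * q) q
  refine ⟨w, fun t => Matrix.of fun ik j =>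
    ∑ d ∈ Finset.range (q + 1), PowerSeries.coeff d (B ik j) * (t : ℂ) ^ d, ?_⟩
  -- Regard polynomials over power series as power series over polynomials.
  let Φ : MvPolynomial (Fin m × Fin m) ℂ⟦X⟧ →+* (MvPolynomial (Fin m × Fin m) ℂ)⟦X⟧ :=
    eval₂Hom (PowerSeries.map C) fun j => PowerSeries.C (X j)
  have hΦF : Φ (map (algebraMap ℂ ℂ⟦X⟧) F) = PowerSeries.C F := by
    have : Φ.comp (map (algebraMap ℂ ℂ⟦X⟧)) = PowerSeries.C := by
      apply MvPolynomial.ringHom_ext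
      · intro c
        simp [Φ]
      · intro j
        simp [Φ]
    exact congrArg (fun φ : MvPolynomial (Fin m × Fin m) ℂ →+* _ => φ F) this
  have hΦX (k : ℕ) : Φ (C (PowerSeries.X ^ k)) = PowerSeries.X ^ k := by
    simp [Φ]
  set Y : Matrix (Fin m) (Fin m) (MvPolynomial (Fin m × Fin m) ℂ)⟦X⟧ :=
    Matrix.of fun i k => ∑ j, PowerSeries.map C (B (i, k) j) * PowerSeries.C (X j) with hY
  have hcoeff : PowerSeries.coeff q Y.det = F := by
    have h1 := congrArg Φ hB
    rw [linSubst_detPoly, RingHom.map_det, map_add, map_mul, map_mul, hΦX, hΦX, hΦF] at h1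
    have h2 : Φ.mapMatrix (Matrix.of fun i k => ∑ j, C (B (i, k) j) * X j) = Y := by
      ext i k : 1
      simp [Φ, hY]
    rw [h2] at h1
    rw [h1, map_add, PowerSeries.coeff_X_pow_mul', PowerSeries.coeff_X_pow_mul']
    simp
  set Z : Matrix (Fin m) (Fin m) (Polynomial (MvPolynomial (Fin m × Fin m) ℂ)) :=
    Matrix.of fun i k => PowerSeries.trunc (q + 1) (Y i k) with hZ
  have hZF : Z.det.coeff q = F := by
    rw [← hcoeff, ← Polynomial.coeff_coe]
    have h1 : ((Z.det : Polynomial _) : (MvPolynomial (Fin m × Fin m) ℂ)⟦X⟧) =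
        (Polynomial.coeToPowerSeries.ringHom.mapMatrix Z).det := by
      rw [← RingHom.map_det]
      rfl
    rw [h1]
    apply coeff_det_eq_of_coeff_eq
    intro i k d hd
    simp only [RingHom.mapMatrix_apply, Matrix.map_apply, hZ, Matrix.of_apply,
      Polynomial.coeToPowerSeries.ringHom_apply, Polynomial.coeff_coe]
    rw [PowerSeries.coeff_trunc, if_pos (Nat.lt_succ_of_le hd)]
  have hdeg : Z.det.natDegree ≤ m * q :=
    natDegree_det_le Z fun i k => Nat.lt_succ_iff.1 (PowerSeries.natDegree_trunc_lt _ _)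
  rw [← hZF, hw Z.det hdeg]
  refine Finset.sum_congr rfl fun t _ => ?_
  rw [algebraMap_eq, linSubst_detPoly, ← Polynomial.coe_evalRingHom, RingHom.map_det]
  congr 2
  ext i k : 1
  have hZik : (Z i k).eval (C (t : ℂ)) = ∑ d ∈ Finset.range (q + 1),
      PowerSeries.coeff d (Y i k) * C (t : ℂ) ^ d := by
    exact PowerSeries.eval₂_trunc_eq_sum_range _ (RingHom.id _) _ _
  rw [RingHom.mapMatrix_apply, Matrix.map_apply, Polynomial.coe_evalRingHom, hZik]
  simp only [hY, Matrix.of_apply, map_sum, Finset.sum_mul, PowerSeries.coeff_mul_C,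
    PowerSeries.coeff_map, map_mul, map_pow]
  rw [Finset.sum_comm]
  exact Finset.sum_congr rfl fun j _ => Finset.sum_congr rfl fun d _ => by ring

end Interpolation

/-! ### Comparison of the complexity classes -/

/-- A dehomogenized form that is approximated with order `q` has small weakly-skew complexity. -/
theorem ApproximableWithOrder.Lws_dehom_le {m q : ℕ} {F : MvPolynomial (Fin m × Fin m) ℂ}
    (h : ApproximableWithOrder m F q) (e : Fin m × Fin m → Option ℕ) :
    Lws (dehom e F) ≤ (2 * ((m * q + 1) * (detCost (m * m) m + 1 + 1) + 1) : ℕ) := by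
  obtain ⟨w, B, rfl⟩ := h.exists_eq_sum_linSubst
  have hdet (t : ℕ) : SkewCost ∅ {dehom e (linSubst (B t) (detPoly m))} (detCost (m * m) m) := by
    rw [linSubst_detPoly, AlgHom.map_det]
    have := SkewCost.det (S := ∅) (ξ := dehomVar e) (isInput_dehomVar e)
      (Y := (dehom e).mapMatrix
        (Matrix.of fun i k => ∑ j, MvPolynomial.C (B t (i, k) j) * MvPolynomial.X j))
      fun i k => ⟨B t (i, k), by simp [dehom, MvPolynomial.algebraMap_eq]⟩
    simpa using this
  have hsum := SkewCost.sum (Finset.range (m * q + 1)) fun t _ =>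
    (hdet t).mul_input (.inl ⟨w t, rfl⟩)
  rw [Finset.card_range] at hsum
  refine hsum.Lws_le ?_
  simp [dehom, MvPolynomial.algebraMap_eq]

theorem exists_polynomial_eval_eq_detCost :
    ∃ D : Polynomial ℕ, ∀ m, D.eval m = detCost (m * m) m := by
  let V : Polynomial ℕ := .X * (.X * (.X * .X * 3 + 1 + 1) + 1)
  let T : Polynomial ℕ := .X * (1 + .X * V + 1) + 1
  exact ⟨(.X + 1) * ((.X + 1) * (T + 1 + 1) + 1 + 1), fun m => by
    simp [V, T, detCost, traceCost, vecMulCost]⟩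

theorem approxLws_le_Lws (f : MvPolynomial ℕ ℂ) : approxLws f ≤ Lws f := by
  let _ := limitTopology
  cases h : Lws f with
  | top => exact le_top
  | coe r => exact sInf_le ⟨r, subset_closure h.le, rfl⟩

theorem mem_closure_of_approxLws_le {f : MvPolynomial ℕ ℂ} {r : ℕ} (h : approxLws f ≤ r) :
    f ∈ @closure _ limitTopology {g | Lws g ≤ r} := by
  let _ := limitTopology
  have hne : {s : ℕ∞ | ∃ r : ℕ, f ∈ closure {g | Lws g ≤ r} ∧ (r : ℕ∞) = s}.Nonempty := by
    by_contra hemp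
    rw [approxLws, Set.not_nonempty_iff_eq_empty.1 hemp, sInf_empty] at h
    exact absurd h (by simp)
  obtain ⟨r', hr', heq⟩ := csInf_mem hne
  rw [← approxLws] at heq
  refine closure_mono (fun g hg => ?_) hr'
  exact le_trans hg (heq.le.trans h)

end GCT

theorem mainTheorem3
    (h : ∃ p : Polynomial ℕ, ∀ (n : ℕ) (f : MvPolynomial (Fin n × Fin n) ℂ),
      f ∈ GCT.detOrbitClosure n → ∃ q : ℕ, q ≤ p.eval n ∧ GCT.ApproximableWithOrder n f q) :
    GCT.VPws = GCT.approxVPws := by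
  obtain ⟨p, hp⟩ := h
  ext f
  constructor
  · rintro ⟨t, ht⟩
    exact ⟨t, fun n => (GCT.approxLws_le_Lws (f n)).trans (ht n)⟩
  · rintro ⟨t, ht⟩
    obtain ⟨D, hD⟩ := GCT.exists_polynomial_eval_eq_detCost
    refine ⟨(2 * ((.X * p + 1) * (D + 1 + 1) + 1) : Polynomial ℕ).comp (t + 1), fun n => ?_⟩
    obtain ⟨e, F, hF, hFf⟩ :=
      GCT.exists_mem_detOrbitClosure (GCT.mem_closure_of_approxLws_le (ht n))
    obtain ⟨q, hq, hFq⟩ := hp _ F hF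
    have hL := hFq.Lws_dehom_le e
    rw [hFf] at hL
    refine hL.trans ?_
    rw [← hD]
    simp only [Polynomial.eval_comp, Polynomial.eval_mul, Polynomial.eval_add, Polynomial.eval_X,
      Polynomial.eval_one, Polynomial.eval_ofNat]
    gcongr
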